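/- All graphs are finite and simple. For a graph $G$ and a set $S\subseteq V(G)$ with $|S|\ge 2$, let $\lambda(S)$ be the maximum number of pairwise edge-disjoint trees in $G$ (subgraphs of $G$ that are trees) whose vertex sets all contain $S$. For $k\ge 2$ let $\lambda_k(G)=\min\{\lambda(S): S\subseteq V(G),\ |S|=k\}$ if $G$ is connected, and $\lambda_k(G)=0$ if $G$ is disconnected. Let $\lambda(G)$ denote the edge-connectivity, $d_G(v)$ the degree of $v$, and $\overline G$ the complement of $G$. Consider the following classes of graphs of order $n$: - $\mathcal G_n^1$ ($n\ge 4$): the graphs $G$ with $\lambda(G)=1$ that have a vertex $v_1$ with $d_G(v_1)=n-1$; - $\mathcal G_n^2$ ($n\ge 5$): the graphs $G$ with $\lambda(G)=2$ that have a vertex $u_1$ with $d_G(u_1)=n-1$ and two adjacent vertices $v_1,v_2$ of degree $2$, both adjacent to $u_1$; - $\mathcal G_n^3$ ($n\ge 5$): the graphs $G$ with $\lambda(G)=2$ that have a vertex $v_1$ with $d_G(v_1)=n-1$. For $n\ge5$ let $K_{2,n-2}^{+}$ be any graph obtained from the complete bipartite graph $K_{2,n-2}$ by adding one edge inside the part with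 $n-2$ vertices. Let $P_m$ and $C_m$ be the path and the cycle on $m$ vertices, and let $K_4\setminus e$ be $K_4$ with one edge deleted. **Proposition.** Let $3\le k\le n$ and let $G$ be a graph of order $n$. Then $\lambda_k(G)+\lambda_k(\overline G)=1$ if and only if at least one graph $H\in\{G,\overline G\}$ satisfies one of the following conditions: 1. $H\in\mathcal G_n^1$ or $H\in\mathcal G_n^2$; 2. $H\in\mathcal G_n^3$ and, for some vertex $v_1$ with $d_H(v_1)=n-1$, the graph $H\setminus v_1$ has a connected component that is a tree with fewer than $k$ vertices; 3. $k=n\ge 5$ and $H\in\{K_{2,n-2}^{+},K_{2,n-2}\}$; or $k=n=3$ and $H\in\{P_3,C_3\}$; or $k=n=4$ and $H\in\{C_4,K_4\setminus e\}$; or $k=n=6$ and $H=K_{3,3}$; or $k=n-1$, $n\ge5$ and $H=K_{2,n-2}$; or $k=n-1=3$ and $H=C_4$. (Equalities of graphs are up to isomorphism.) -/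

import Mathlib

namespace GenEdgeConn

/-- `G` contains `l` pairwise edge-disjoint `S`-Steiner trees: subgraphs of `G` that are trees
and whose vertex sets contain `S`. -/
def HasSteinerTrees {V : Type*} (G : SimpleGraph V) (S : Finset V) (l : ℕ) : Prop :=
  ∃ T : Fin l → G.Subgraph,
    (∀ i, (T i).coe.IsTree ∧ (S : Set V) ⊆ (T i).verts) ∧
    ∀ i j, i ≠ j → Disjoint (T i).edgeSet (T j).edgeSet

/-- The generalized local edge-connectivity `λ(S)`: the maximum number of pairwise edge-disjoint
trees in `G` connecting `S`. In a finite graph, and for `S` with at least two vertices, the set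
below is finite, since each tree has an edge. -/
noncomputable def localLambda {V : Type*} (G : SimpleGraph V) (S : Finset V) : ℕ :=
  sSup {l : ℕ | HasSteinerTrees G S l}

open Classical in
/-- The generalized `k`-edge-connectivity `λ_k(G)`: the minimum of `λ(S)` over all `k`-subsets `S`
of the vertex set, and `0` for a disconnected graph. -/
noncomputable def genLambda {V : Type*} (G : SimpleGraph V) (k : ℕ) : ℕ :=
  if G.Connected then sInf {m : ℕ | ∃ S : Finset V, S.card = k ∧ localLambda G S = m} else 0

/-- The edge-connectivity `λ(G)` of a finite graph on at least two vertices: the largest `l`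
such that deleting fewer than `l` edges never disconnects `G`. -/
noncomputable def edgeConn {V : Type*} (G : SimpleGraph V) : ℕ :=
  sSup {l : ℕ | G.IsEdgeConnected l}

/-- The degree of a vertex of a finite graph. -/
noncomputable def deg {V : Type*} (G : SimpleGraph V) (v : V) : ℕ :=
  (G.neighborSet v).ncard

/-- The class `𝒢_n^1` (`n ≥ 4`): edge-connectivity `1` and a vertex of degree `n - 1`. -/
def ClassG1 {V : Type*} (G : SimpleGraph V) : Prop :=
  4 ≤ Nat.card V ∧ edgeConn G = 1 ∧ ∃ v₁ : V, deg G v₁ = Nat.card V - 1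

/-- The class `𝒢_n^2` (`n ≥ 5`): edge-connectivity `2`, a vertex `u₁` of degree `n - 1`, and two
adjacent vertices `v₁`, `v₂` of degree `2`, both joined to `u₁`. -/
def ClassG2 {V : Type*} (G : SimpleGraph V) : Prop :=
  5 ≤ Nat.card V ∧ edgeConn G = 2 ∧ ∃ u₁ v₁ v₂ : V, deg G u₁ = Nat.card V - 1 ∧
    G.Adj u₁ v₁ ∧ G.Adj u₁ v₂ ∧ G.Adj v₁ v₂ ∧ deg G v₁ = 2 ∧ deg G v₂ = 2

/-- The class `𝒢_n^3` (`n ≥ 5`), with its distinguished vertex `v₁`: edge-connectivity `2`, and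
`v₁` has degree `n - 1`. -/
def ClassG3 {V : Type*} (G : SimpleGraph V) (v₁ : V) : Prop :=
  5 ≤ Nat.card V ∧ edgeConn G = 2 ∧ deg G v₁ = Nat.card V - 1

/-- The graph `G ∖ v`. -/
abbrev deleteVertex {V : Type*} (G : SimpleGraph V) (v : V) :
    SimpleGraph ({v}ᶜ : Set V) :=
  G.induce ({v}ᶜ : Set V)

/-- Some component of `G ∖ v` is a tree with fewer than `k` vertices. -/
def HasSmallTreeComponent {V : Type*} (G : SimpleGraph V) (v : V) (k : ℕ) : Prop :=
  ∃ C : (deleteVertex G v).ConnectedComponent, C.toSimpleGraph.IsTree ∧ C.supp.ncard < k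

/-- `G` is (isomorphic to) `H`. -/
def IsCopy {V W : Type*} (G : SimpleGraph V) (H : SimpleGraph W) : Prop :=
  Nonempty (G ≃g H)

/-- The complete bipartite graph `K_{a,b}`. -/
abbrev completeBip (a b : ℕ) : SimpleGraph (Fin a ⊕ Fin b) :=
  completeBipartiteGraph (Fin a) (Fin b)

/-- `G` is (isomorphic to) `K_{2,m}^+`: the graph `K_{2,m}` with one edge added inside the part
that has `m` vertices. -/
def IsK2Plus {V : Type*} (G : SimpleGraph V) (m : ℕ) : Prop :=
  ∃ a b : Fin m, a ≠ b ∧ IsCopy G (completeBip 2 m ⊔ SimpleGraph.edge (Sum.inr a) (Sum.inr b))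

/-- `K_4 ∖ e`, the complete graph on four vertices with one edge deleted. -/
def K4MinusEdge : SimpleGraph (Fin 4) :=
  (⊤ : SimpleGraph (Fin 4)).deleteEdges {s(0, 1)}

/-- The exceptional graphs. -/
def IsException {V : Type*} (G : SimpleGraph V) (n k : ℕ) : Prop :=
  (k = n ∧ 5 ≤ n ∧ (IsK2Plus G (n - 2) ∨ IsCopy G (completeBip 2 (n - 2)))) ∨
  (k = n ∧ n = 3 ∧ (IsCopy G (SimpleGraph.pathGraph 3) ∨ IsCopy G (SimpleGraph.cycleGraph 3))) ∨
  (k = n ∧ n = 4 ∧ (IsCopy G (SimpleGraph.cycleGraph 4) ∨ IsCopy G K4MinusEdge)) ∨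
  (k = n ∧ n = 6 ∧ IsCopy G (completeBip 3 3)) ∨
  (k = n - 1 ∧ 5 ≤ n ∧ IsCopy G (completeBip 2 (n - 2))) ∨
  (k = n - 1 ∧ k = 3 ∧ IsCopy G (SimpleGraph.cycleGraph 4))

/-- `G` satisfies one of the three conditions of the characterization. -/
def IsExtremal {V : Type*} (G : SimpleGraph V) (k : ℕ) : Prop :=
  (ClassG1 G ∨ ClassG2 G) ∨
  (∃ v₁ : V, ClassG3 G v₁ ∧ HasSmallTreeComponent G v₁ k) ∨
  IsException G (Nat.card V) k

end GenEdgeConn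

namespace GenEdgeConn

open SimpleGraph

variable {V : Type*}

/-! Since `genLambda` is positive exactly on connected graphs, a sum of 1 means that one of the two
graphs is connected with value 1 and the other is disconnected; this is `Deficient`. The graph with
disconnected complement is a join across a partition of the vertices, and the proof decides when a
join lacks two edge-disjoint trees for some `k`-set.

Obstructions come from counting: orienting a tree towards a root outside `C` gives every vertex of
`C` its own edge, so two trees need `2 * C.card` edges touching `C`
(`two_mul_card_le_of_hasSteinerTrees`). A bridge is the other obstruction.

Conversely, let `v` be universal. A spanning forest of `G ∖ v`, hung on `v` by one edge per
component, leaves enough edges for a second tree unless some component is a small tree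
(`hasSteinerTrees_two_of_universal`). A leaf of that component has degree at most 2 in `G`, which
bounds the edge-connectivity.

Without a universal vertex both sides of the join have at least two vertices. If one has exactly
two, two modified stars centred there work up to few exceptions (`isException_of_two_side`). If both
have at least three, `K_{3,4}` splits into two spanning paths, and only `K_{3,3}` remains
(`isException_of_three_le`). -/

/-! ### Steiner trees and reachability -/

lemma HasSteinerTrees.mono {G : SimpleGraph V} {S : Finset V} {l m : ℕ} (hlm : l ≤ m)
    (h : HasSteinerTrees G S m) : HasSteinerTrees G S l := by
  obtain ⟨T, hT, hd⟩ := h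
  exact ⟨fun i => T (Fin.castLE hlm i), fun i => hT _,
    fun i j hij => hd _ _ fun h => hij (Fin.castLE_injective hlm h)⟩

lemma edgeSet_nonempty_of_connected_coe {G : SimpleGraph V} {T : G.Subgraph}
    (hT : T.coe.Connected) {a b : V} (ha : a ∈ T.verts) (hb : b ∈ T.verts) (hab : a ≠ b) :
    T.edgeSet.Nonempty := by
  have : Nontrivial T.verts := ⟨⟨a, ha⟩, ⟨b, hb⟩, fun h => hab (congrArg Subtype.val h)⟩
  obtain ⟨c, hc⟩ := hT.preconnected.exists_adj_of_nontrivial ⟨a, ha⟩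
  exact ⟨s(a, c), hc⟩

lemma bddAbove_hasSteinerTrees [Finite V] (G : SimpleGraph V) {S : Finset V} (hS : 2 ≤ S.card) :
    BddAbove {l : ℕ | HasSteinerTrees G S l} := by
  classical
  have := Fintype.ofFinite V
  refine ⟨Fintype.card (Sym2 V), ?_⟩
  rintro l ⟨T, hT, hd⟩
  obtain ⟨a, ha, b, hb, hab⟩ := Finset.one_lt_card.1 hS
  choose e he using fun i => edgeSet_nonempty_of_connected_coe (hT i).1.connected
    ((hT i).2 ha) ((hT i).2 hb) hab
  have hinj : Function.Injective e := by
    intro i j hij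
    by_contra hne
    exact Set.disjoint_left.1 (hd i j hne) (he i) (hij ▸ he j)
  simpa using Fintype.card_le_of_injective e hinj

lemma le_localLambda_iff [Finite V] (G : SimpleGraph V) {S : Finset V} (hS : 2 ≤ S.card) {l : ℕ} :
    l ≤ localLambda G S ↔ HasSteinerTrees G S l := by
  constructor
  · intro h
    have hne : {l : ℕ | HasSteinerTrees G S l}.Nonempty := ⟨0, Fin.elim0, by simp, by simp⟩
    exact HasSteinerTrees.mono h (Nat.sSup_mem hne (bddAbove_hasSteinerTrees G hS))
  · exact fun h => le_csSup (bddAbove_hasSteinerTrees G hS) h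

/-- If the vertices of `S` lie in one component of `H ≤ G`, then `H` contains a Steiner tree
for `S`. -/
lemma exists_tree_of_reachable {G H : SimpleGraph V} (hle : H ≤ G) {S : Finset V} {r : V}
    (hr : ∀ s ∈ S, H.Reachable r s) :
    ∃ T : G.Subgraph, T.coe.IsTree ∧ (S : Set V) ⊆ T.verts ∧ T.edgeSet ⊆ H.edgeSet := by
  -- The tree is the component of `r` in a spanning forest of `H`.
  obtain ⟨F, hFH, hF, hFr⟩ := H.exists_isAcyclic_reachable_eq_le
  let C := F.connectedComponentMk r
  refine ⟨⟨C.supp, fun a b => a ∈ C.supp ∧ b ∈ C.supp ∧ F.Adj a b,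
    fun h => hle (hFH h.2.2), fun h => h.1, ?_⟩, ?_, ?_, ?_⟩
  · exact ⟨fun a b h => ⟨h.2.1, h.1, h.2.2.symm⟩⟩
  · refine Iso.isTree_iff ⟨Equiv.refl _, ?_⟩ |>.1 (hF.isTree_connectedComponent C)
    intro a b
    exact ⟨fun h => h.2.2, fun h => ⟨a.2, b.2, h⟩⟩
  · intro s hs
    have : F.Reachable r s := hFr ▸ hr s hs
    exact ConnectedComponent.sound this.symm
  · intro e
    induction e with
    | h a b => exact fun h => hFH h.2.2

lemma hasSteinerTrees_one_of_connected {G : SimpleGraph V} (hG : G.Connected) (S : Finset V) :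
    HasSteinerTrees G S 1 := by
  obtain ⟨r⟩ := hG.nonempty
  obtain ⟨T, hT, hS, -⟩ := exists_tree_of_reachable le_rfl
    (fun s (_ : s ∈ S) => hG.preconnected r s)
  exact ⟨fun _ => T, fun _ => ⟨hT, hS⟩, fun i j hij => (hij (Subsingleton.elim i j)).elim⟩

/-- Every later construction goes through reachability in two edge-disjoint subgraphs, so acyclicity
never has to be checked by hand. -/
lemma hasSteinerTrees_two_of_reachable {G H₁ H₂ : SimpleGraph V} (h₁ : H₁ ≤ G) (h₂ : H₂ ≤ G)
    (hd : ∀ a b, H₁.Adj a b → ¬ H₂.Adj a b) {S : Finset V} {r₁ r₂ : V}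
    (hr₁ : ∀ s ∈ S, H₁.Reachable r₁ s) (hr₂ : ∀ s ∈ S, H₂.Reachable r₂ s) :
    HasSteinerTrees G S 2 := by
  obtain ⟨T₁, hT₁, hS₁, he₁⟩ := exists_tree_of_reachable h₁ hr₁
  obtain ⟨T₂, hT₂, hS₂, he₂⟩ := exists_tree_of_reachable h₂ hr₂
  have hdis : Disjoint T₁.edgeSet T₂.edgeSet := by
    refine Set.disjoint_left.2 fun e h h' => ?_
    induction e with
    | h a b => exact hd a b (he₁ h) (he₂ h')
  refine ⟨![T₁, T₂], ?_, ?_⟩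
  · intro i
    fin_cases i
    · exact ⟨hT₁, hS₁⟩
    · exact ⟨hT₂, hS₂⟩
  · intro i j hij
    fin_cases i <;> fin_cases j
    · exact (hij rfl).elim
    · exact hdis
    · exact hdis.symm
    · exact (hij rfl).elim

lemma hasSteinerTrees_two_iff {G : SimpleGraph V} {S : Finset V} :
    HasSteinerTrees G S 2 ↔ ∃ T₁ T₂ : G.Subgraph, (T₁.coe.IsTree ∧ (S : Set V) ⊆ T₁.verts) ∧
      (T₂.coe.IsTree ∧ (S : Set V) ⊆ T₂.verts) ∧ Disjoint T₁.edgeSet T₂.edgeSet := by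
  constructor
  · rintro ⟨T, hT, hd⟩
    exact ⟨T 0, T 1, hT 0, hT 1, hd 0 1 (by decide)⟩
  · rintro ⟨T₁, T₂, h₁, h₂, hd⟩
    refine ⟨![T₁, T₂], ?_, ?_⟩
    · intro i
      fin_cases i
      · exact h₁
      · exact h₂
    · intro i j hij
      fin_cases i <;> fin_cases j
      · exact (hij rfl).elim
      · exact hd
      · exact hd.symm
      · exact (hij rfl).elim

/-! ### Counting edges that touch a vertex set -/

lemma exists_adj_dist_eq_add_one {G : SimpleGraph V} (hG : G.Connected) {u r : V} (h : u ≠ r) :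
    ∃ d, G.Adj u d ∧ G.dist u r = G.dist d r + 1 := by
  obtain ⟨p, hp⟩ := hG.exists_walk_length_eq_dist u r
  cases p with
  | nil => exact (h rfl).elim
  | @cons _ d _ hud q =>
    refine ⟨d, hud, ?_⟩
    simp only [Walk.length_cons] at hp
    have h1 := dist_le q
    have h2 := hG.dist_triangle (u := u) (v := d) (w := r)
    rw [dist_eq_one_iff_adj.2 hud] at h2
    omega

/-- A connected subgraph has at least `C.card` edges touching a set `C` of its vertices, unless
`C` consists of all of them. -/
lemma card_le_ncard_touching [Finite V] {G : SimpleGraph V} {T : G.Subgraph} (hT : T.coe.Connected)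
    {C : Finset V} (hC : (C : Set V) ⊆ T.verts) {r : V} (hr : r ∈ T.verts) (hrC : r ∉ C) :
    C.card ≤ {e ∈ T.edgeSet | ∃ c ∈ C, c ∈ e}.ncard := by
  classical
  let R : T.verts := ⟨r, hr⟩
  have key : ∀ c : C, ∃ d : T.verts, T.coe.Adj ⟨c.1, hC c.2⟩ d ∧
      T.coe.dist ⟨c.1, hC c.2⟩ R = T.coe.dist d R + 1 := by
    rintro ⟨c, hc⟩
    refine exists_adj_dist_eq_add_one hT fun h => hrC ?_
    have : c = r := congrArg Subtype.val h
    rwa [← this]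
  choose d hd hdist using key
  -- Each vertex of `C` gets the first edge of a shortest path to `r`. Two vertices sharing this
  -- edge would each be nearer to `r` than the other.
  let f : C → Sym2 V := fun c => s(c.1, (d c).1)
  have hf : Function.Injective f := by
    intro c c' h
    by_contra hne
    have hne' : (c : V) ≠ c' := fun h => hne (Subtype.ext h)
    rcases Sym2.eq_iff.1 h with ⟨h1, -⟩ | ⟨h1, h2⟩
    · exact hne' h1
    · have e1 : (⟨c.1, hC c.2⟩ : T.verts) = d c' := Subtype.ext h1
      have e2 : d c = (⟨c'.1, hC c'.2⟩ : T.verts) := Subtype.ext h2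
      have := hdist c
      have := hdist c'
      rw [← e1] at this
      rw [e2] at *
      omega
  have hmem : Set.range f ⊆ {e ∈ T.edgeSet | ∃ c ∈ C, c ∈ e} := by
    rintro _ ⟨c, rfl⟩
    exact ⟨hd c, c, c.2, Sym2.mem_mk_left _ _⟩
  calc C.card = Nat.card C := by simp
    _ = (Set.range f).ncard := by
      rw [← Nat.card_coe_set_eq, Nat.card_range_of_injective hf]
    _ ≤ _ := Set.ncard_le_ncard hmem (Set.toFinite _)

/-- Two edge-disjoint Steiner trees for a set that contains `C` and more need `2 * C.card` edges
touching `C`. -/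
lemma two_mul_card_le_of_hasSteinerTrees [Finite V] {G : SimpleGraph V} {S C : Finset V}
    (h : HasSteinerTrees G S 2) (hC : C ⊂ S) :
    2 * C.card ≤ {e ∈ G.edgeSet | ∃ c ∈ C, c ∈ e}.ncard := by
  obtain ⟨T₁, T₂, ⟨h₁, hS₁⟩, ⟨h₂, hS₂⟩, hd⟩ := hasSteinerTrees_two_iff.1 h
  obtain ⟨r, hr, hrC⟩ := Finset.exists_of_ssubset hC
  have hCS' : (C : Set V) ⊆ S := by exact_mod_cast hC.1
  have e₁ := card_le_ncard_touching h₁.connected (hCS'.trans hS₁) (hS₁ hr) hrC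
  have e₂ := card_le_ncard_touching h₂.connected (hCS'.trans hS₂) (hS₂ hr) hrC
  have hd' : Disjoint {e ∈ T₁.edgeSet | ∃ c ∈ C, c ∈ e} {e ∈ T₂.edgeSet | ∃ c ∈ C, c ∈ e} :=
    hd.mono (Set.sep_subset _ _) (Set.sep_subset _ _)
  have hu := Set.ncard_union_eq hd' (Set.toFinite _) (Set.toFinite _)
  have hle : ({e ∈ T₁.edgeSet | ∃ c ∈ C, c ∈ e} ∪ {e ∈ T₂.edgeSet | ∃ c ∈ C, c ∈ e}).ncard ≤
      {e ∈ G.edgeSet | ∃ c ∈ C, c ∈ e}.ncard := by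
    refine Set.ncard_le_ncard ?_ (Set.toFinite _)
    rintro e (⟨h, hc⟩ | ⟨h, hc⟩)
    · exact ⟨T₁.edgeSet_subset h, hc⟩
    · exact ⟨T₂.edgeSet_subset h, hc⟩
  omega

/-! ### Reduction to a connected graph with disconnected complement -/

/-- `G` is connected, its complement is not, and some `k`-subset of the vertices does not have
two edge-disjoint Steiner trees. -/
def Deficient (G : SimpleGraph V) (k : ℕ) : Prop :=
  G.Connected ∧ ¬ Gᶜ.Connected ∧ ∃ S : Finset V, S.card = k ∧ ¬ HasSteinerTrees G S 2

lemma genLambda_le {G : SimpleGraph V} {k : ℕ} (hG : G.Connected) {S : Finset V} (hS : S.card = k) :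
    genLambda G k ≤ localLambda G S := by
  rw [genLambda, if_pos hG]
  exact Nat.sInf_le ⟨S, hS, rfl⟩

section GenLambda

variable [Fintype V] (G : SimpleGraph V) {k : ℕ}

lemma exists_localLambda_eq_genLambda (hG : G.Connected) (hkn : k ≤ Fintype.card V) :
    ∃ S : Finset V, S.card = k ∧ localLambda G S = genLambda G k := by
  classical
  have hne : {m : ℕ | ∃ S : Finset V, S.card = k ∧ localLambda G S = m}.Nonempty := by
    obtain ⟨S, -, hS⟩ := Finset.exists_subset_card_eq (s := (Finset.univ : Finset V)) hkn
    exact ⟨_, S, hS, rfl⟩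
  have := Nat.sInf_mem hne
  rwa [genLambda, if_pos hG]

lemma one_le_genLambda_iff (hk : 2 ≤ k) (hkn : k ≤ Fintype.card V) :
    1 ≤ genLambda G k ↔ G.Connected := by
  constructor
  · intro h
    by_contra hG
    rw [genLambda, if_neg hG] at h
    omega
  · intro hG
    obtain ⟨S, hS, hl⟩ := exists_localLambda_eq_genLambda G hG hkn
    rw [← hl, le_localLambda_iff G (hS ▸ hk)]
    exact hasSteinerTrees_one_of_connected hG S

lemma genLambda_le_one_iff (hG : G.Connected) (hk : 2 ≤ k) (hkn : k ≤ Fintype.card V) :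
    genLambda G k ≤ 1 ↔ ∃ S : Finset V, S.card = k ∧ ¬ HasSteinerTrees G S 2 := by
  constructor
  · intro h
    obtain ⟨S, hS, hl⟩ := exists_localLambda_eq_genLambda G hG hkn
    refine ⟨S, hS, ?_⟩
    rw [← le_localLambda_iff G (hS ▸ hk)]
    omega
  · rintro ⟨S, hS, h⟩
    rw [← le_localLambda_iff G (hS ▸ hk)] at h
    have := genLambda_le hG hS
    omega

lemma genLambda_add_eq_one_iff (hk : 2 ≤ k) (hkn : k ≤ Fintype.card V) :
    genLambda G k + genLambda Gᶜ k = 1 ↔ Deficient G k ∨ Deficient Gᶜ k := by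
  have h1 := one_le_genLambda_iff G hk hkn
  have h2 := one_le_genLambda_iff Gᶜ hk hkn
  have h3 := fun h => genLambda_le_one_iff G h hk hkn
  have h4 := fun h => genLambda_le_one_iff Gᶜ h hk hkn
  simp only [Deficient, compl_compl]
  by_cases hG : G.Connected <;> by_cases hG' : Gᶜ.Connected <;>
    simp only [hG, hG', true_and, false_and, iff_true, iff_false, not_true, not_false_iff, or_false,
      false_or] at h1 h2 ⊢
  -- Both graphs connected: the sum is at least 2.
  · omega
  · rw [← h3 hG]; omega
  · rw [← h4 hG']; omega
  · omega

end GenLambda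

/-! ### Joins, and obstructions to two trees -/

lemma connected_and_not_connected_compl_of_cross {G : SimpleGraph V} {A : Set V} (hA : A.Nonempty)
    (hA' : Aᶜ.Nonempty) (h : ∀ a ∈ A, ∀ b ∉ A, G.Adj a b) : G.Connected ∧ ¬ Gᶜ.Connected := by
  obtain ⟨a, ha⟩ := hA
  obtain ⟨b, hb⟩ := hA'
  constructor
  · have : ∀ x, G.Reachable a x := by
      intro x
      by_cases hx : x ∈ A
      · exact (h a ha b hb).reachable.trans (h x hx b hb).reachable.symm
      · exact (h a ha x hx).reachable
    exact { preconnected := fun x y => (this x).symm.trans (this y), nonempty := ⟨a⟩ }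
  · intro hc
    obtain ⟨p⟩ := hc.preconnected a b
    obtain ⟨d, -, hd1, hd2⟩ := p.exists_boundary_dart A ha hb
    exact d.adj.2 (h _ hd1 _ hd2)

lemma not_hasSteinerTrees_univ_of_ncard_edgeSet_lt [Fintype V] {G : SimpleGraph V}
    [Nonempty V] (h : G.edgeSet.ncard < 2 * (Fintype.card V - 1)) :
    ¬ HasSteinerTrees G Finset.univ 2 := by
  classical
  intro hT
  obtain ⟨r⟩ := ‹Nonempty V›
  have h1 := two_mul_card_le_of_hasSteinerTrees hT (Finset.erase_ssubset (Finset.mem_univ r))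
  rw [Finset.card_erase_of_mem (Finset.mem_univ r), Finset.card_univ] at h1
  have h2 := Set.ncard_le_ncard (Set.sep_subset G.edgeSet
    fun e => ∃ c ∈ Finset.univ.erase r, c ∈ e) (Set.toFinite _)
  omega

lemma ncard_verts_le_ncard_edgeSet_add_one [Finite V] {G : SimpleGraph V} {T : G.Subgraph}
    (hT : T.coe.Connected) : T.verts.ncard ≤ T.edgeSet.ncard + 1 := by
  classical
  have := Fintype.ofFinite V
  obtain ⟨r⟩ := hT.nonempty
  have h1 := card_le_ncard_touching hT (C := T.verts.toFinset.erase r) (by simp) r.2 (by simp)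
  have h2 := Set.ncard_le_ncard (Set.sep_subset T.edgeSet
    fun e => ∃ c ∈ T.verts.toFinset.erase r, c ∈ e) (Set.toFinite _)
  rw [Finset.card_erase_of_mem (by simp), ← Set.ncard_eq_toFinset_card'] at h1
  omega

/-- Two trees avoiding `u` would use at least `2 * (n - 2)` edges, hence all of them, yet no edge at
`u`, which has a neighbour by connectedness. A tree through `u` needs one edge more, which exceeds
the total. -/
lemma not_hasSteinerTrees_erase_of_ncard_edgeSet_le [Fintype V] [DecidableEq V]
    {G : SimpleGraph V} (hG : G.Connected) (hn : 3 ≤ Fintype.card V)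
    (h : G.edgeSet.ncard ≤ 2 * (Fintype.card V - 2)) (u : V) :
    ¬ HasSteinerTrees G (Finset.univ.erase u) 2 := by
  intro hT
  obtain ⟨T₁, T₂, ⟨h₁, hS₁⟩, ⟨h₂, hS₂⟩, hd⟩ := hasSteinerTrees_two_iff.1 hT
  have hc : (↑(Finset.univ.erase u) : Set V).ncard = Fintype.card V - 1 := by
    rw [Set.ncard_coe_finset, Finset.card_erase_of_mem (Finset.mem_univ u), Finset.card_univ]
  have c₁ := ncard_verts_le_ncard_edgeSet_add_one h₁.connected
  have c₂ := ncard_verts_le_ncard_edgeSet_add_one h₂.connected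
  have hle : ∀ T : G.Subgraph, (↑(Finset.univ.erase u) : Set V) ⊆ T.verts →
      Fintype.card V - 1 ≤ T.verts.ncard ∧ (u ∈ T.verts → Fintype.card V ≤ T.verts.ncard) := by
    intro T hS
    refine ⟨hc ▸ Set.ncard_le_ncard hS (Set.toFinite _), fun hu => ?_⟩
    have : T.verts = Set.univ := by
      ext x
      by_cases hx : x = u
      · simp [hx, hu]
      · simp [hS (show x ∈ (↑(Finset.univ.erase u) : Set V) by simp [hx])]
    rw [this, Set.ncard_univ, Nat.card_eq_fintype_card]
  have v₁ := hle T₁ hS₁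
  have v₂ := hle T₂ hS₂
  have hu := Set.ncard_union_eq hd (Set.toFinite _) (Set.toFinite _)
  have hsub : T₁.edgeSet ∪ T₂.edgeSet ⊆ G.edgeSet :=
    Set.union_subset T₁.edgeSet_subset T₂.edgeSet_subset
  have hl := Set.ncard_le_ncard hsub (Set.toFinite _)
  by_cases hu₁ : u ∈ T₁.verts
  · have := v₁.2 hu₁
    omega
  by_cases hu₂ : u ∈ T₂.verts
  · have := v₂.2 hu₂
    omega
  have : Nontrivial V := Fintype.one_lt_card_iff_nontrivial.1 (by omega)
  obtain ⟨w, hw⟩ := hG.preconnected.exists_adj_of_nontrivial u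
  have hlt : (T₁.edgeSet ∪ T₂.edgeSet).ncard < G.edgeSet.ncard := by
    refine Set.ncard_lt_ncard ⟨hsub, fun h => ?_⟩ (Set.toFinite _)
    rcases h (show s(u, w) ∈ G.edgeSet from hw) with h | h
    · exact hu₁ (T₁.edge_vert h)
    · exact hu₂ (T₂.edge_vert h)
  omega

lemma adj_of_deg_eq [Fintype V] {G : SimpleGraph V} {v w : V}
    (h : deg G v = Nat.card V - 1) (hw : w ≠ v) : G.Adj v w := by
  classical
  by_contra hvw
  have hsub : G.neighborSet v ⊆ ({v, w} : Set V)ᶜ := by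
    intro x hx
    simp only [Set.mem_compl_iff, Set.mem_insert_iff, Set.mem_singleton_iff, not_or]
    exact ⟨fun h => G.loopless.irrefl _ (h ▸ hx), fun h => hvw (h ▸ hx)⟩
  have h1 := Set.ncard_le_ncard hsub (Set.toFinite _)
  have h2 := Set.ncard_add_ncard_compl ({v, w} : Set V) (Set.toFinite _) (Set.toFinite _)
  rw [Set.ncard_pair hw.symm] at h2
  rw [deg] at h
  omega

lemma deg_eq_of_forall_adj [Fintype V] {G : SimpleGraph V} {v : V}
    (h : ∀ w, w ≠ v → G.Adj v w) : deg G v = Nat.card V - 1 := by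
  classical
  have hN : G.neighborSet v = ({v} : Set V)ᶜ := by
    ext x
    exact ⟨fun hx hv => G.loopless.irrefl _ (hv ▸ hx : G.Adj v v), fun hx => h x hx⟩
  have h2 := Set.ncard_add_ncard_compl ({v} : Set V) (Set.toFinite _) (Set.toFinite _)
  rw [Set.ncard_singleton] at h2
  rw [deg, hN]
  omega

lemma connected_and_not_connected_compl_of_universal [Nontrivial V] {G : SimpleGraph V} {v : V}
    (h : ∀ w, w ≠ v → G.Adj v w) : G.Connected ∧ ¬ Gᶜ.Connected := by
  refine connected_and_not_connected_compl_of_cross (A := {v}) ⟨v, rfl⟩ (exists_ne v) ?_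
  rintro _ rfl b hb
  exact h b hb

lemma bddAbove_isEdgeConnected [Fintype V] [Nontrivial V] (G : SimpleGraph V) :
    BddAbove {l : ℕ | G.IsEdgeConnected l} := by
  classical
  obtain ⟨v⟩ := (inferInstance : Nonempty V)
  exact ⟨G.degree v, fun l hl => hl.le_degree⟩

lemma le_edgeConn_iff [Fintype V] [Nontrivial V] (G : SimpleGraph V) {l : ℕ} :
    l ≤ edgeConn G ↔ G.IsEdgeConnected l := by
  constructor
  · intro h
    have hm := Nat.sSup_mem ⟨0, IsEdgeConnected.zero⟩ (bddAbove_isEdgeConnected G)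
    exact fun u v => (hm u v).anti h
  · exact fun h => le_csSup (bddAbove_isEdgeConnected G) h

/-- A tree containing both `u` and `v` must use the bridge `e`, and only one of two disjoint trees
can. -/
lemma not_hasSteinerTrees_of_not_reachable_deleteEdges {G : SimpleGraph V} {S : Finset V}
    {u v : V} (hu : u ∈ S) (hv : v ∈ S) {e : Sym2 V}
    (h : ¬ (G.deleteEdges {e}).Reachable u v) : ¬ HasSteinerTrees G S 2 := by
  intro hT
  obtain ⟨T₁, T₂, ⟨h₁, hS₁⟩, ⟨h₂, hS₂⟩, hd⟩ := hasSteinerTrees_two_iff.1 hT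
  have key : ∀ T : G.Subgraph, T.coe.Connected → (S : Set V) ⊆ T.verts → e ∈ T.edgeSet := by
    intro T hT hS
    by_contra he
    refine h ?_
    let f : T.coe →g G.deleteEdges {e} := ⟨Subtype.val, fun {a b} hab => by
      rw [deleteEdges_adj]
      exact ⟨T.adj_sub hab, fun h => he (h ▸ hab)⟩⟩
    exact (hT.preconnected ⟨u, hS hu⟩ ⟨v, hS hv⟩).map f
  exact Set.disjoint_left.1 hd (key T₁ h₁.connected hS₁) (key T₂ h₂.connected hS₂)

lemma exists_superset_card [Fintype V] {C : Finset V} {k : ℕ} (hC : C.card ≤ k)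
    (hk : k ≤ Fintype.card V) : ∃ S : Finset V, C ⊆ S ∧ S.card = k := by
  obtain ⟨S, h1, -, h2⟩ := Finset.exists_subsuperset_card_eq (Finset.subset_univ C) hC hk
  exact ⟨S, h1, h2⟩

lemma mem_pair_of_ncard_eq_two {s : Set V} (hs : s.ncard = 2) {a b x : V} (ha : a ∈ s)
    (hb : b ∈ s) (hab : a ≠ b) (hx : x ∈ s) : x = a ∨ x = b := by
  have h : ({a, b} : Set V) = s := by
    refine Set.eq_of_subset_of_ncard_le ?_ (by rw [hs, Set.ncard_pair hab])
      (Set.finite_of_ncard_ne_zero (by omega))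
    rintro y (rfl | rfl) <;> assumption
  rw [← h] at hx
  exact hx

/-! ### The three classes are deficient -/

section Classes

variable [Fintype V] {G : SimpleGraph V} {k : ℕ}

lemma Deficient.of_classG1 (hk : 3 ≤ k) (hkn : k ≤ Fintype.card V) (h : ClassG1 G) :
    Deficient G k := by
  classical
  obtain ⟨-, hl, v, hv⟩ := h
  have : Nontrivial V := Fintype.one_lt_card_iff_nontrivial.1 (by omega)
  have hc := connected_and_not_connected_compl_of_universal fun w hw => adj_of_deg_eq hv hw
  refine ⟨hc.1, hc.2, ?_⟩
  have h2 : ¬ G.IsEdgeConnected 2 := by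
    rw [← le_edgeConn_iff, hl]
    omega
  rw [isEdgeConnected_two] at h2
  simp only [Preconnected, not_forall] at h2
  obtain ⟨e, a, b, hab⟩ := h2
  obtain ⟨S, hCS, hS⟩ := exists_superset_card (C := {a, b}) (k := k)
    (Finset.card_le_two.trans (by omega)) hkn
  exact ⟨S, hS, not_hasSteinerTrees_of_not_reachable_deleteEdges (hCS (by simp)) (hCS (by simp))
    hab⟩

lemma Deficient.of_few_touching [Nontrivial V] (hkn : k ≤ Fintype.card V) {v : V}
    (hv : deg G v = Nat.card V - 1) {C : Finset V} (hC : C.card < k)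
    (ht : {e ∈ G.edgeSet | ∃ c ∈ C, c ∈ e}.ncard < 2 * C.card) : Deficient G k := by
  have hc := connected_and_not_connected_compl_of_universal fun w hw => adj_of_deg_eq hv hw
  obtain ⟨S, hCS, hS⟩ := exists_superset_card hC.le hkn
  refine ⟨hc.1, hc.2, S, hS, fun h => ?_⟩
  -- The inclusion must be strict: the counting bound needs a root in `S` outside `C`.
  have hss : C ⊂ S := hCS.ssubset_of_ne fun h => by
    rw [h] at hC
    omega
  have := two_mul_card_le_of_hasSteinerTrees h hss
  omega

/-- Only the three edges of the triangle touch the two vertices of degree 2, and four would be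
needed. -/
lemma Deficient.of_classG2 (hk : 3 ≤ k) (hkn : k ≤ Fintype.card V) (h : ClassG2 G) :
    Deficient G k := by
  classical
  obtain ⟨-, -, u, a, b, hu, hua, hub, hab, ha, hb⟩ := h
  have : Nontrivial V := Fintype.one_lt_card_iff_nontrivial.1 (by omega)
  have hC : ({a, b} : Finset V).card = 2 := Finset.card_pair hab.ne
  refine Deficient.of_few_touching hkn hu (C := {a, b}) (by omega) ?_
  have hsub : {e ∈ G.edgeSet | ∃ c ∈ ({a, b} : Finset V), c ∈ e} ⊆
      (↑({s(a, b), s(a, u), s(b, u)} : Finset (Sym2 V)) : Set (Sym2 V)) := by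
    rintro e ⟨he, c, hc, hce⟩
    obtain ⟨d, rfl⟩ := Sym2.mem_iff_exists.1 hce
    have hcd : G.Adj c d := he
    simp only [Finset.mem_insert, Finset.mem_singleton] at hc
    simp only [Finset.coe_insert, Finset.coe_singleton, Set.mem_insert_iff, Set.mem_singleton_iff]
    rcases hc with rfl | rfl
    · rcases mem_pair_of_ncard_eq_two ha hab hua.symm hub.ne.symm hcd with rfl | rfl <;> simp
    · rcases mem_pair_of_ncard_eq_two hb hab.symm hub.symm hua.ne.symm hcd with rfl | rfl <;> simp
  have h1 := Set.ncard_le_ncard hsub (Set.toFinite _)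
  rw [Set.ncard_coe_finset] at h1
  have := Finset.card_le_three (a := s(a, b)) (b := s(a, u)) (c := s(b, u))
  omega

/-- A tree component with `c` vertices is touched by its own `c - 1` edges and by `c` edges to `v`:
one fewer than `2 * c`. -/
lemma Deficient.of_hasSmallTreeComponent [Nontrivial V] (hkn : k ≤ Fintype.card V) {v : V}
    (hv : deg G v = Nat.card V - 1) (h : HasSmallTreeComponent G v k) : Deficient G k := by
  classical
  obtain ⟨C, hC, hCk⟩ := h
  let C' : Finset V := (C.supp.toFinset).map (Function.Embedding.subtype _)
  have hC' : C'.card = C.supp.ncard := by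
    rw [Finset.card_map, Set.ncard_eq_toFinset_card']
  refine Deficient.of_few_touching hkn hv (C := C') (by omega) ?_
  let f : C.toSimpleGraph.edgeSet ⊕ C.supp → Sym2 V :=
    Sum.elim (fun e => e.1.map fun x => x.1.1) fun c => s(c.1.1, v)
  have hsub : {e ∈ G.edgeSet | ∃ c ∈ C', c ∈ e} ⊆ Set.range f := by
    rintro e ⟨he, c, hc, hce⟩
    obtain ⟨d, rfl⟩ := Sym2.mem_iff_exists.1 hce
    have hcd : G.Adj c d := he
    simp only [C', Finset.mem_map, Set.mem_toFinset] at hc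
    obtain ⟨c, hc, rfl⟩ := hc
    by_cases hd : d = v
    · exact ⟨Sum.inr ⟨c, hc⟩, by subst hd; rfl⟩
    · have hadj : (deleteVertex G v).Adj c ⟨d, hd⟩ := hcd
      have hd' : (⟨d, hd⟩ : ({v}ᶜ : Set V)) ∈ C.supp := by
        rw [ConnectedComponent.mem_supp_iff] at hc ⊢
        rw [← hc]
        exact ConnectedComponent.sound hadj.symm.reachable
      exact ⟨Sum.inl ⟨s(⟨c, hc⟩, ⟨_, hd'⟩), hadj⟩, rfl⟩
  have h1 := Set.ncard_le_ncard hsub (Set.toFinite _)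
  have h2 : (Set.range f).ncard ≤ Nat.card (C.toSimpleGraph.edgeSet ⊕ C.supp) := by
    rw [← Nat.card_coe_set_eq]
    exact Finite.card_range_le f
  have h3 := hC.card_edgeFinset
  rw [Nat.card_sum, Nat.card_coe_set_eq C.supp] at h2
  rw [edgeFinset_card, ← Nat.card_eq_fintype_card, ← Nat.card_eq_fintype_card] at h3
  have h4 := h3.trans (Nat.card_congr (Equiv.subtypeEquivRight (q := (· ∈ C.supp)) fun _ => Iff.rfl))
  rw [show Nat.card {x // x ∈ C.supp} = C.supp.ncard from Nat.card_coe_set_eq C.supp] at h4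
  omega

end Classes

/-! ### The exceptional graphs are deficient -/

lemma cross_of_iso {W : Type*} {G : SimpleGraph V} {H : SimpleGraph W} (e : G ≃g H) {A : Set W}
    (hA : A.Nonempty) (hA' : Aᶜ.Nonempty) (h : ∀ a ∈ A, ∀ b ∉ A, H.Adj a b) :
    G.Connected ∧ ¬ Gᶜ.Connected := by
  refine connected_and_not_connected_compl_of_cross (A := e ⁻¹' A) ?_ ?_ ?_
  · obtain ⟨a, ha⟩ := hA
    exact ⟨e.symm a, by simpa using ha⟩
  · obtain ⟨a, ha⟩ := hA'
    exact ⟨e.symm a, by simpa using ha⟩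
  · intro a ha b hb
    exact e.map_adj_iff.1 (h _ ha _ hb)

lemma ncard_edgeSet_of_iso {W : Type*} {G : SimpleGraph V} {H : SimpleGraph W} (e : G ≃g H) :
    G.edgeSet.ncard = H.edgeSet.ncard := by
  rw [← Nat.card_coe_set_eq, ← Nat.card_coe_set_eq]
  exact Nat.card_congr e.mapEdgeSet

lemma cross_of_iso_of_completeBip_le {G : SimpleGraph V} {a b : ℕ} {H : SimpleGraph (Fin a ⊕ Fin b)}
    (hH : completeBip a b ≤ H) (e : G ≃g H) (ha : 0 < a) (hb : 0 < b) :
    G.Connected ∧ ¬ Gᶜ.Connected := by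
  refine cross_of_iso e (A := Set.range Sum.inl) ⟨_, ⟨0, ha⟩, rfl⟩ ⟨Sum.inr ⟨0, hb⟩, by simp⟩ ?_
  rintro _ ⟨x, rfl⟩ y hy
  rcases y with y | y
  · simp at hy
  · exact hH (by simp)

lemma ncard_edgeSet_completeBip (a b : ℕ) : (completeBip a b).edgeSet.ncard = a * b := by
  have := encard_edgeSet_completeBipartiteGraph (W₁ := Fin a) (W₂ := Fin b)
  rw [Set.ncard, this]
  simp

lemma ncard_edgeSet_completeBip_sup_edge_le (a b : ℕ) (x y : Fin a ⊕ Fin b) :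
    (completeBip a b ⊔ edge x y).edgeSet.ncard ≤ a * b + 1 := by
  rw [edgeSet_sup]
  refine (Set.ncard_union_le _ _).trans ?_
  rw [ncard_edgeSet_completeBip]
  have h1 := Set.ncard_le_ncard (edgeSet_edge_subset : (edge x y).edgeSet ⊆ {s(x, y)})
    (Set.toFinite _)
  rw [Set.ncard_singleton] at h1
  omega

/-- The isomorphism between `K_{2,2}` and the cycle on four vertices. -/
def cycleIso : cycleGraph 4 ≃g completeBip 2 2 where
  toFun := ![Sum.inl 0, Sum.inr 0, Sum.inl 1, Sum.inr 1]
  invFun := Sum.elim ![0, 2] ![1, 3]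
  left_inv := by intro x; fin_cases x <;> rfl
  right_inv := by rintro (x | x) <;> fin_cases x <;> rfl
  map_rel_iff' := by
    intro a b
    fin_cases a <;> fin_cases b <;> simp [cycleGraph_adj] <;> decide

/-- The isomorphism between `K_4` minus an edge and `K_{2,2}` with an extra edge. -/
def k4MinusEdgeIso : K4MinusEdge ≃g (completeBip 2 2 ⊔ edge (Sum.inr 0) (Sum.inr 1)) where
  toFun := ![Sum.inl 0, Sum.inl 1, Sum.inr 0, Sum.inr 1]
  invFun := Sum.elim ![0, 1] ![2, 3]
  left_inv := by intro x; fin_cases x <;> rfl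
  right_inv := by rintro (x | x) <;> fin_cases x <;> rfl
  map_rel_iff' := by
    intro a b
    fin_cases a <;> fin_cases b <;> simp [K4MinusEdge, edge_adj]

section

variable [Fintype V] {G : SimpleGraph V} {k : ℕ}

lemma Deficient.of_few_edges (hG : G.Connected ∧ ¬ Gᶜ.Connected) (hk : k = Fintype.card V)
    (h : G.edgeSet.ncard < 2 * (Fintype.card V - 1)) : Deficient G k := by
  have := hG.1.nonempty
  exact ⟨hG.1, hG.2, Finset.univ, hk.symm ▸ Finset.card_univ,
    not_hasSteinerTrees_univ_of_ncard_edgeSet_lt h⟩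

lemma Deficient.of_isK2Plus (hn : 4 ≤ Fintype.card V)
    (h : IsK2Plus G (Fintype.card V - 2)) : Deficient G (Fintype.card V) := by
  obtain ⟨a, b, -, ⟨e⟩⟩ := h
  refine Deficient.of_few_edges
    (cross_of_iso_of_completeBip_le le_sup_left e (by omega) (by omega)) rfl ?_
  -- At most `2 * (n - 2) + 1` edges, one short of the `2 * (n - 1)` that two spanning trees use.
  have := ncard_edgeSet_completeBip_sup_edge_le 2 (Fintype.card V - 2) (Sum.inr a) (Sum.inr b)
  rw [ncard_edgeSet_of_iso e]
  omega

lemma Deficient.of_isCopy_completeBip_two (hn : 4 ≤ Fintype.card V)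
    (h : IsCopy G (completeBip 2 (Fintype.card V - 2)))
    (hk : k = Fintype.card V ∨ k = Fintype.card V - 1) : Deficient G k := by
  classical
  obtain ⟨e⟩ := h
  have hc := cross_of_iso_of_completeBip_le le_rfl e (by omega) (by omega)
  have he := ncard_edgeSet_of_iso e
  rw [ncard_edgeSet_completeBip] at he
  rcases hk with rfl | rfl
  · exact Deficient.of_few_edges hc rfl (by omega)
  · obtain ⟨u⟩ := hc.1.nonempty
    refine ⟨hc.1, hc.2, Finset.univ.erase u, ?_,
      not_hasSteinerTrees_erase_of_ncard_edgeSet_le hc.1 (by omega) he.le u⟩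
    rw [Finset.card_erase_of_mem (Finset.mem_univ u), Finset.card_univ]

lemma Deficient.of_three (hn : Fintype.card V = 3) (hG : G.Connected ∧ ¬ Gᶜ.Connected) :
    Deficient G 3 := by
  classical
  refine Deficient.of_few_edges hG hn.symm ?_
  have h := G.card_edgeFinset_le_card_choose_two
  rw [hn] at h ⊢
  rw [Set.ncard_eq_toFinset_card']
  have : Nat.choose 3 2 = 3 := rfl
  change G.edgeFinset.card < _
  omega

lemma Deficient.of_isException (hk : 3 ≤ k)
    (h : IsException G (Nat.card V) k) : Deficient G k := by
  rw [Nat.card_eq_fintype_card] at h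
  rcases h with ⟨rfl, hn, h | h⟩ | ⟨rfl, hn, ⟨⟨e⟩⟩ | ⟨⟨e⟩⟩⟩ | ⟨rfl, hn, ⟨⟨e⟩⟩ | ⟨⟨e⟩⟩⟩ |
    ⟨rfl, hn, ⟨e⟩⟩ | ⟨hkn, hn, h⟩ | ⟨hkn, rfl, ⟨e⟩⟩
  · exact Deficient.of_isK2Plus (by omega) h
  · exact Deficient.of_isCopy_completeBip_two (by omega) h (Or.inl rfl)
  · rw [hn]
    refine Deficient.of_three hn (cross_of_iso e (A := {1}) ⟨1, rfl⟩ ⟨0, by simp⟩ ?_)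
    rintro _ rfl b hb
    fin_cases b <;> simp_all [pathGraph_adj]
  · rw [hn]
    refine Deficient.of_three hn (cross_of_iso e (A := {1}) ⟨1, rfl⟩ ⟨0, by simp⟩ ?_)
    rintro _ rfl b hb
    fin_cases b <;> simp_all [cycleGraph_adj]
  · refine Deficient.of_isCopy_completeBip_two (by omega) ?_ (Or.inl rfl)
    rw [hn]
    exact ⟨e.trans cycleIso⟩
  · refine Deficient.of_isK2Plus (by omega) ?_
    rw [hn]
    exact ⟨0, 1, by decide, ⟨e.trans k4MinusEdgeIso⟩⟩
  -- `K_{3,3}` has 9 edges, and two spanning trees on six vertices need 10.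
  · refine Deficient.of_few_edges
      (cross_of_iso_of_completeBip_le le_rfl e (by omega) (by omega)) rfl ?_
    rw [ncard_edgeSet_of_iso e, ncard_edgeSet_completeBip]
    omega
  · exact Deficient.of_isCopy_completeBip_two (by omega) h (Or.inr hkn)
  · have hn : Fintype.card V = 4 := by omega
    refine Deficient.of_isCopy_completeBip_two hn.ge ?_ (Or.inr hkn)
    rw [hn]
    exact ⟨e.trans cycleIso⟩

lemma Deficient.of_isExtremal (hk : 3 ≤ k) (hkn : k ≤ Fintype.card V) (h : IsExtremal G k) :
    Deficient G k := by
  have : Nontrivial V := Fintype.one_lt_card_iff_nontrivial.1 (by omega)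
  rcases h with (h | h) | ⟨v, ⟨-, -, hv⟩, h⟩ | h
  · exact Deficient.of_classG1 hk hkn h
  · exact Deficient.of_classG2 hk hkn h
  · exact Deficient.of_hasSmallTreeComponent hkn hv h
  · exact Deficient.of_isException hk h

end

/-! ### Joins with a universal vertex -/

/-- The subgraphs can be given by oriented edge lists; since `fromRel` symmetrizes, disjointness is
required in both orientations. -/
lemma hasSteinerTrees_two_of_rel {G : SimpleGraph V} {R₁ R₂ : V → V → Prop}
    (h₁ : ∀ p q, R₁ p q → G.Adj p q) (h₂ : ∀ p q, R₂ p q → G.Adj p q)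
    (hd : ∀ p q, R₁ p q → ¬ R₂ p q) (hd' : ∀ p q, R₁ p q → ¬ R₂ q p) {S : Finset V} {r₁ r₂ : V}
    (hr₁ : ∀ s ∈ S, (fromRel R₁).Reachable r₁ s) (hr₂ : ∀ s ∈ S, (fromRel R₂).Reachable r₂ s) :
    HasSteinerTrees G S 2 := by
  refine hasSteinerTrees_two_of_reachable (H₁ := fromRel R₁) (H₂ := fromRel R₂) ?_ ?_ ?_ hr₁ hr₂
  · rintro a b ⟨-, h | h⟩
    · exact h₁ _ _ h
    · exact (h₁ _ _ h).symm
  · rintro a b ⟨-, h | h⟩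
    · exact h₂ _ _ h
    · exact (h₂ _ _ h).symm
  · rintro a b ⟨-, h | h⟩ ⟨-, h' | h'⟩
    · exact hd _ _ h h'
    · exact hd' _ _ h h'
    · exact hd' _ _ h h'
    · exact hd _ _ h h'

/-- One tree lies inside `C`, the other in the star at `v`. -/
lemma hasSteinerTrees_two_of_component {G : SimpleGraph V} {v : V} (hv : ∀ w, w ≠ v → G.Adj v w)
    {S : Finset V} (C : (deleteVertex G v).ConnectedComponent)
    (hS : ∀ s ∈ S, ∃ c ∈ C.supp, c.1 = s) : HasSteinerTrees G S 2 := by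
  let H₁ : SimpleGraph V := (deleteVertex G v).map (Function.Embedding.subtype _)
  let H₂ : SimpleGraph V := fromRel fun p q => p = v ∧ q ≠ v
  obtain ⟨r, hr⟩ := C.nonempty_supp
  refine hasSteinerTrees_two_of_reachable (H₁ := H₁) (H₂ := H₂) (r₁ := r) (r₂ := v) ?_ ?_ ?_ ?_ ?_
  · rintro a b ⟨-, a, b, h, rfl, rfl⟩
    exact h
  · rintro a b ⟨-, ⟨rfl, h⟩ | ⟨rfl, h⟩⟩
    · exact hv _ h
    · exact (hv _ h).symm
  · rintro a b ⟨-, a, b, h, rfl, rfl⟩ ⟨-, ⟨h1, -⟩ | ⟨h1, -⟩⟩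
    · exact a.2 h1
    · exact b.2 h1
  · intro s hs
    obtain ⟨c, hc, rfl⟩ := hS s hs
    exact (C.reachable_of_mem_supp hr hc).map (Embedding.map _ _).toHom
  · intro s hs
    obtain ⟨c, hc, rfl⟩ := hS s hs
    have h : (c : V) ≠ v := c.2
    exact Adj.reachable ⟨h.symm, Or.inl ⟨rfl, h⟩⟩

/-- Let `F` be a spanning forest of `G ∖ v`, where `v` is universal, and let every component have
a vertex `x` outside `S` or with an edge not in `F`. Then `F` with the edges from `v` to the
vertices `x`, and the other edges of `G`, both connect `S`. -/
lemma hasSteinerTrees_two_of_forest {G : SimpleGraph V} {v : V} (hv : ∀ w, w ≠ v → G.Adj v w)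
    {S : Finset V} {F : SimpleGraph ({v}ᶜ : Set V)} (hF : F ≤ deleteVertex G v)
    (hFr : F.Reachable = (deleteVertex G v).Reachable)
    (x : (deleteVertex G v).ConnectedComponent → ({v}ᶜ : Set V)) (hx : ∀ C, x C ∈ C.supp)
    (hxS : ∀ C, (x C : V) ∉ S ∨ ∃ y, (deleteVertex G v).Adj (x C) y ∧ ¬ F.Adj (x C) y) :
    HasSteinerTrees G S 2 := by
  let R₁ : V → V → Prop := fun p q =>
    (∃ a b, F.Adj a b ∧ p = a.1 ∧ q = b.1) ∨ (p = v ∧ ∃ C, q = x C)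
  let R₂ : V → V → Prop := fun p q =>
    (∃ a b, (deleteVertex G v).Adj a b ∧ ¬ F.Adj a b ∧ p = a.1 ∧ q = b.1) ∨
      (p = v ∧ q ≠ v ∧ ∀ C, q ≠ x C)
  have hR₁ : ∀ p q, R₁ p q → G.Adj p q := by
    rintro p q (⟨a, b, h, rfl, rfl⟩ | ⟨rfl, C, rfl⟩)
    · exact hF h
    · exact hv _ (x C).2
  have hR₂ : ∀ p q, R₂ p q → G.Adj p q := by
    rintro p q (⟨a, b, h, -, rfl, rfl⟩ | ⟨rfl, h, -⟩)
    · exact h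
    · exact hv _ h
  have hR₁₂ : ∀ p q, R₁ p q → ¬ R₂ p q := by
    rintro p q (⟨a, b, h, rfl, rfl⟩ | ⟨rfl, C, rfl⟩) (⟨a', b', h1, h2, h3, h4⟩ | ⟨h1, -, h3⟩)
    · obtain rfl := Subtype.ext h3
      obtain rfl := Subtype.ext h4
      exact h2 h
    · exact a.2 h1
    · exact a'.2 h3.symm
    · exact h3 C rfl
  have hR₁₂' : ∀ p q, R₁ p q → ¬ R₂ q p := by
    rintro p q (⟨a, b, h, rfl, rfl⟩ | ⟨rfl, C, rfl⟩) (⟨a', b', h1, h2, h3, h4⟩ | ⟨h1, h2, -⟩)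
    · obtain rfl := Subtype.ext h3
      obtain rfl := Subtype.ext h4
      exact h2 h.symm
    · exact b.2 h1
    · exact b'.2 h4.symm
    · exact h2 rfl
  have adj₁ : ∀ {p q}, R₁ p q → (fromRel R₁).Adj p q := fun h => ⟨(hR₁ _ _ h).ne, Or.inl h⟩
  have adj₂ : ∀ {p q}, R₂ p q → (fromRel R₂).Adj p q := fun h => ⟨(hR₂ _ _ h).ne, Or.inl h⟩
  refine hasSteinerTrees_two_of_rel hR₁ hR₂ hR₁₂ hR₁₂' (r₁ := v) (r₂ := v) ?_ ?_
  · intro s hs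
    by_cases hsv : s = v
    · rw [hsv]
    let f : F →g fromRel R₁ := ⟨Subtype.val, fun {a b} h => adj₁ (Or.inl ⟨a, b, h, rfl, rfl⟩)⟩
    let C := (deleteVertex G v).connectedComponentMk ⟨s, hsv⟩
    have h1 : F.Reachable (x C) ⟨s, hsv⟩ := by
      rw [hFr]
      exact C.reachable_of_mem_supp (hx C) rfl
    exact (adj₁ (Or.inr ⟨rfl, C, rfl⟩)).reachable.trans (h1.map f)
  · intro s hs
    by_cases hsv : s = v
    · rw [hsv]
    by_cases h : ∀ C, s ≠ x C
    · exact (adj₂ (Or.inr ⟨rfl, hsv, h⟩)).reachable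
    push Not at h
    obtain ⟨C, rfl⟩ := h
    -- The edge from `v` to `x C` is taken by the first subgraph, so the second reaches `x C`
    -- through `y`. As `y` lies in `C` and differs from `x C`, its edge to `v` is free.
    obtain ⟨y, hy, hFy⟩ := (hxS C).resolve_left (not_not.2 hs)
    have hyC : y ∈ C.supp := by
      rw [← (C.mem_supp_iff _).1 (hx C)]
      exact ConnectedComponent.sound hy.symm.reachable
    have hyx : ∀ C', (y : V) ≠ x C' := by
      intro C' h
      have h := Subtype.ext h
      have hC' := hx C'
      rw [← h, ConnectedComponent.mem_supp_iff, (C.mem_supp_iff _).1 hyC] at hC'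
      subst hC'
      exact hy.ne h.symm
    exact (adj₂ (Or.inr ⟨rfl, y.2, hyx⟩)).reachable.trans
      (adj₂ (Or.inl ⟨_, _, hy, hFy, rfl, rfl⟩)).reachable.symm

lemma hasSteinerTrees_two_of_universal [Fintype V] {G : SimpleGraph V} {v : V}
    (hv : ∀ w, w ≠ v → G.Adj v w) {S : Finset V} (h : ¬ HasSmallTreeComponent G v S.card) :
    HasSteinerTrees G S 2 := by
  classical
  by_cases hC : ∃ C : (deleteVertex G v).ConnectedComponent,
      C.toSimpleGraph.IsTree ∧ ∀ c ∈ C.supp, c.1 ∈ S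
  · obtain ⟨C, hT, hCS⟩ := hC
    refine hasSteinerTrees_two_of_component hv C ?_
    let C' : Finset V := (C.supp.toFinset).map (Function.Embedding.subtype _)
    have hC' : C'.card = C.supp.ncard := by
      rw [Finset.card_map, Set.ncard_eq_toFinset_card']
    have hsub : C' ⊆ S := by
      intro a ha
      simp only [C', Finset.mem_map, Set.mem_toFinset] at ha
      obtain ⟨c, hc, rfl⟩ := ha
      exact hCS c hc
    -- A tree component inside `S` is not small, so it is all of `S`.
    have hcard : S.card ≤ C'.card := by
      rw [hC']
      exact not_lt.1 fun hlt => h ⟨C, hT, hlt⟩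
    intro s hs
    rw [← Finset.eq_of_subset_of_card_le hsub hcard] at hs
    simpa [C'] using hs
  · obtain ⟨F, hF, hFa, hFr⟩ := (deleteVertex G v).exists_isAcyclic_reachable_eq_le
    have key : ∀ C : (deleteVertex G v).ConnectedComponent, ∃ x ∈ C.supp,
        (x : V) ∉ S ∨ ∃ y, (deleteVertex G v).Adj x y ∧ ¬ F.Adj x y := by
      intro C
      -- Otherwise `C` lies in `S` and all its edges are in `F`, so it is a tree inside `S`, which
      -- is excluded here.
      by_contra! hcon
      refine hC ⟨C, ⟨C.connected_toSimpleGraph, ?_⟩, fun c hc => (hcon c hc).1⟩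
      let f : C.toSimpleGraph →g F := ⟨Subtype.val, fun {a b} hab => (hcon a.1 a.2).2 b.1 hab⟩
      exact hFa.comap f Subtype.val_injective
    choose x hx hxS using key
    exact hasSteinerTrees_two_of_forest hv hF hFr x hx hxS

/-- A component that is a tree has a vertex with at most one neighbour. -/
lemma exists_mem_supp_forall_adj_eq {W : Type*} [Finite W] {D : SimpleGraph W}
    {C : D.ConnectedComponent} (hC : C.toSimpleGraph.IsTree) :
    ∃ c ∈ C.supp, ∃ d, ∀ w, D.Adj c w → w = d := by
  classical
  have := Fintype.ofFinite W
  have hmem : ∀ (c : C) (w : W), D.Adj c.1 w → w ∈ C := by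
    intro c w h
    have h' : D.connectedComponentMk w = D.connectedComponentMk c.1 :=
      ConnectedComponent.sound h.symm.reachable
    exact (C.mem_supp_iff w).2 (h'.trans ((C.mem_supp_iff _).1 c.2))
  cases subsingleton_or_nontrivial C with
  -- For an isolated vertex the witness `d = c` is a dummy.
  | inl hs =>
    obtain ⟨c, hc⟩ := C.nonempty_supp
    refine ⟨c, hc, c, fun w h => ?_⟩
    have h1 : (⟨c, hc⟩ : C) = ⟨_, hmem ⟨c, hc⟩ w h⟩ := Subsingleton.elim _ _
    exact (congrArg Subtype.val h1).symm
  | inr hn =>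
    obtain ⟨c, hc⟩ := hC.exists_vert_degree_one_of_nontrivial
    obtain ⟨d, hd, hu⟩ := degree_eq_one_iff_existsUnique_adj.1 hc
    exact ⟨c.1, c.2, d.1, fun w h => congrArg Subtype.val (hu ⟨_, hmem c w h⟩ h)⟩

lemma exists_mem_supp_forall_adj_of_isTree [Fintype V] {G : SimpleGraph V} {v : V}
    {C : (deleteVertex G v).ConnectedComponent} (hC : C.toSimpleGraph.IsTree) :
    ∃ c ∈ C.supp, ∃ d : V, ∀ w, G.Adj c w → w = v ∨ w = d := by
  obtain ⟨c, hc, d, hd⟩ := exists_mem_supp_forall_adj_eq hC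
  refine ⟨c, hc, d, fun w h => ?_⟩
  by_cases hw : w = v
  · exact Or.inl hw
  · exact Or.inr (congrArg Subtype.val (hd ⟨w, hw⟩ h))

lemma isCopy_of_injective {W : Type*} [Fintype V] [Fintype W] {G : SimpleGraph V}
    {H : SimpleGraph W} (f : W → V) (hf : Function.Injective f)
    (hcard : Fintype.card W = Fintype.card V) (h : ∀ a b, G.Adj (f a) (f b) ↔ H.Adj a b) :
    IsCopy G H := by
  let e : W ≃ V := Equiv.ofBijective f ((Fintype.bijective_iff_injective_and_card f).2 ⟨hf, hcard⟩)
  exact ⟨Iso.symm ⟨e, fun {a b} => h a b⟩⟩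

section

variable [Fintype V] {G : SimpleGraph V}

lemma isCopy_pathGraph_or_cycleGraph_three (hn : Fintype.card V = 3) {v : V}
    (hv : ∀ w, w ≠ v → G.Adj v w) : IsCopy G (pathGraph 3) ∨ IsCopy G (cycleGraph 3) := by
  classical
  obtain ⟨x, y, hxy, he⟩ := Finset.card_eq_two.1
    (show (Finset.univ.erase v).card = 2 by simp [hn])
  have hx : x ≠ v := Finset.ne_of_mem_erase (s := Finset.univ) (by simp [he])
  have hy : y ≠ v := Finset.ne_of_mem_erase (s := Finset.univ) (by simp [he])
  have h1 := hv x hx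
  have h2 := hv y hy
  have hinj : Function.Injective ![x, v, y] := by
    intro a b h
    fin_cases a <;> fin_cases b <;> simp_all
  by_cases h : G.Adj x y
  · refine Or.inr (isCopy_of_injective ![x, v, y] hinj (by simp [hn]) fun a b => ?_)
    fin_cases a <;> fin_cases b <;> simp [h, h1, h2, h.symm, h1.symm, h2.symm, cycleGraph_three_eq_top]
  · have h' : ¬ G.Adj y x := fun h' => h h'.symm
    refine Or.inl (isCopy_of_injective ![x, v, y] hinj (by simp [hn]) fun a b => ?_)
    fin_cases a <;> fin_cases b <;> simp [h, h1, h2, h', h1.symm, h2.symm, pathGraph_adj]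

/-- All degrees are at least 2, so a vertex `c` of `C` with at most one neighbour besides `v` has
exactly one, `d'`; the fourth vertex `e` misses `c` and must then be adjacent to `d'`. Thus `C` is
the path `c d' e`, and `ce` is the only missing edge. -/
lemma isCopy_k4MinusEdge (hn : Fintype.card V = 4) {v : V} (hv : ∀ w, w ≠ v → G.Adj v w)
    (hG : G.IsEdgeConnected 2) {C : (deleteVertex G v).ConnectedComponent}
    (hC : C.toSimpleGraph.IsTree) : IsCopy G K4MinusEdge ∧ 3 ≤ C.supp.ncard := by
  classical
  have : Nontrivial V := Fintype.one_lt_card_iff_nontrivial.1 (by omega)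
  have hdeg : ∀ a b : V, ∃ w, G.Adj a w ∧ w ≠ b := by
    intro a b
    obtain ⟨w, hw, hwb⟩ := Finset.exists_mem_ne (s := G.neighborFinset a)
      (by simpa [Nat.lt_iff_add_one_le] using hG.le_degree (u := a)) b
    exact ⟨w, by simpa using hw, hwb⟩
  obtain ⟨c, hc, d, hd⟩ := exists_mem_supp_forall_adj_of_isTree hC
  have hcv : c.1 ≠ v := c.2
  obtain ⟨d', hcd, hdv⟩ := hdeg c v
  obtain rfl := (hd d' hcd).resolve_left hdv
  obtain ⟨e, he⟩ : ∃ e, e ∉ ({v, c.1, d'} : Finset V) := by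
    by_contra! h
    have h1 := Finset.card_le_card (show Finset.univ ⊆ ({v, c.1, d'} : Finset V) from
      fun x _ => h x)
    have h2 := Finset.card_le_three (a := v) (b := c.1) (c := d')
    rw [Finset.card_univ] at h1
    omega
  simp only [Finset.mem_insert, Finset.mem_singleton, not_or] at he
  obtain ⟨hev, hec, hed⟩ := he
  have hce : ¬ G.Adj c e := fun h => (hd e h).elim hev hed
  have hec' : ¬ G.Adj e c := fun h => hce h.symm
  have hinj : Function.Injective ![c.1, e, v, d'] := by
    intro a b h
    have := hcd.ne
    fin_cases a <;> fin_cases b <;> simp_all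
  have hall : ∀ w, w = c.1 ∨ w = e ∨ w = v ∨ w = d' := by
    intro w
    obtain ⟨i, rfl⟩ := ((Fintype.bijective_iff_injective_and_card ![c.1, e, v, d']).2
      ⟨hinj, by simp [hn]⟩).2 w
    fin_cases i <;> simp
  have hde : G.Adj d' e := by
    obtain ⟨w, hw, hwv⟩ := hdeg e v
    rcases hall w with rfl | rfl | rfl | rfl
    · exact (hec' hw).elim
    · exact (hw.ne rfl).elim
    · exact (hwv rfl).elim
    · exact hw.symm
  have a1 := hv _ hcv
  have a2 := hv _ hev
  have a3 := hv _ hdv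
  refine ⟨isCopy_of_injective ![c.1, e, v, d'] hinj (by simp [hn]) fun a b => ?_, ?_⟩
  · fin_cases a <;> fin_cases b <;>
      simp [hce, hec', hcd, hcd.symm, hde, hde.symm, a1, a2, a3, a1.symm, a2.symm, a3.symm,
        K4MinusEdge]
  · have hdC : (⟨d', hdv⟩ : ({v}ᶜ : Set V)) ∈ C.supp := by
      rw [← (C.mem_supp_iff _).1 hc]
      exact ConnectedComponent.sound (Adj.reachable (G := deleteVertex G v) hcd.symm)
    have heC : (⟨e, hev⟩ : ({v}ᶜ : Set V)) ∈ C.supp := by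
      rw [← (C.mem_supp_iff _).1 hdC]
      exact ConnectedComponent.sound (Adj.reachable (G := deleteVertex G v) hde.symm)
    have hsub : (↑({c, ⟨d', hdv⟩, ⟨e, hev⟩} : Finset ({v}ᶜ : Set V)) : Set _) ⊆ C.supp := by
      intro z hz
      simp only [Finset.coe_insert, Finset.coe_singleton, Set.mem_insert_iff,
        Set.mem_singleton_iff] at hz
      rcases hz with rfl | rfl | rfl <;> assumption
    have h3 := Set.ncard_le_ncard hsub (Set.toFinite _)
    rw [Set.ncard_coe_finset, Finset.card_eq_three.2 ⟨c, ⟨d', hdv⟩, ⟨e, hev⟩, ?_, ?_, ?_, rfl⟩] at h3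
    · exact h3
    · exact fun h => hcd.ne (congrArg Subtype.val h)
    · exact fun h => hec (congrArg Subtype.val h).symm
    · exact fun h => hed (congrArg Subtype.val h).symm

/-- The small tree component forces edge-connectivity 1 or 2, and orders 3 and 4 give exceptional
graphs where the classes do not apply. `ClassG2` is not needed: its two vertices of degree 2 already
form a tree component. -/
lemma isExtremal_of_universal {k : ℕ} (hk : 3 ≤ k) (hkn : k ≤ Fintype.card V) {v : V}
    (hv : ∀ w, w ≠ v → G.Adj v w) {S : Finset V} (hS : S.card = k)
    (h : ¬ HasSteinerTrees G S 2) : IsExtremal G k := by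
  classical
  have : Nontrivial V := Fintype.one_lt_card_iff_nontrivial.1 (by omega)
  have hn : Nat.card V = Fintype.card V := Nat.card_eq_fintype_card
  have hsmall : HasSmallTreeComponent G v k := by
    by_contra hcon
    exact h (hasSteinerTrees_two_of_universal hv (hS.symm ▸ hcon))
  have hdv := deg_eq_of_forall_adj hv
  by_cases hn3 : Fintype.card V = 3
  · refine Or.inr (Or.inr (Or.inr (Or.inl ⟨by omega, by omega, ?_⟩)))
    exact isCopy_pathGraph_or_cycleGraph_three hn3 hv
  obtain ⟨C, hC, hCk⟩ := hsmall
  have h1 : 1 ≤ edgeConn G := by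
    rw [le_edgeConn_iff, isEdgeConnected_one]
    exact (connected_and_not_connected_compl_of_universal hv).1.preconnected
  have h2 : edgeConn G ≤ 2 := by
    by_contra hcon
    have h3 : 3 ≤ edgeConn G := by omega
    rw [le_edgeConn_iff] at h3
    obtain ⟨c, -, d, hd⟩ := exists_mem_supp_forall_adj_of_isTree hC
    have h4 := h3.le_degree (u := c.1)
    have hsub : G.neighborFinset c.1 ⊆ {v, d} := by
      intro w hw
      simpa using hd w (by simpa using hw)
    have h5 := (Finset.card_le_card hsub).trans Finset.card_le_two
    rw [card_neighborFinset_eq_degree] at h5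
    omega
  by_cases h3 : edgeConn G = 1
  · exact Or.inl (Or.inl ⟨by omega, h3, v, hdv⟩)
  have h4 : edgeConn G = 2 := by omega
  by_cases hn4 : Fintype.card V = 4
  · obtain ⟨h5, h6⟩ := isCopy_k4MinusEdge hn4 hv ((le_edgeConn_iff G).1 h4.ge) hC
    exact Or.inr (Or.inr (Or.inr (Or.inr (Or.inl ⟨by omega, by omega, Or.inr h5⟩))))
  · exact Or.inr (Or.inl ⟨v, ⟨by omega, h4, hdv⟩, C, hC, hCk⟩)

end

/-! ### Joins with a side of two vertices -/

section TwoSide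

variable {G : SimpleGraph V} {a₁ a₂ : V} {S : Finset V}

lemma reachable_fromRel {R : V → V → Prop} {p q : V} (h : R p q ∨ R q p) :
    (fromRel R).Reachable p q := by
  by_cases hpq : p = q
  · rw [hpq]
  · exact Adj.reachable ⟨hpq, h⟩

/-- The star at `a₁` gives up `y` and the star at `a₂` gives up `w`; the freed edges `a₁y` and `a₂w`
attach each centre to the other star. A given-up vertex that lies in `S` returns by an edge `yx` or
`wz` off the centres, and `hne` keeps these two edges distinct. -/
lemma hasSteinerTrees_two_of_two_side (ha : a₁ ≠ a₂)
    (h₁ : ∀ b, b ≠ a₁ → b ≠ a₂ → G.Adj a₁ b) (h₂ : ∀ b, b ≠ a₁ → b ≠ a₂ → G.Adj a₂ b)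
    {y w x z : V} (hyw : y ≠ w) (hy₁ : y ≠ a₁) (hy₂ : y ≠ a₂) (hw₁ : w ≠ a₁) (hw₂ : w ≠ a₂)
    (hy : y ∈ S → G.Adj y x ∧ x ≠ a₁ ∧ x ≠ a₂) (hw : w ∈ S → G.Adj w z ∧ z ≠ a₁ ∧ z ≠ a₂)
    (hne : y ∈ S → w ∈ S → ¬ (x = w ∧ y = z)) : HasSteinerTrees G S 2 := by
  let R₁ : V → V → Prop := fun p q => (p = a₁ ∧ q ≠ a₁ ∧ q ≠ a₂ ∧ q ≠ y) ∨ (p = a₂ ∧ q = w) ∨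
    (y ∈ S ∧ p = y ∧ q = x)
  let R₂ : V → V → Prop := fun p q => (p = a₂ ∧ q ≠ a₁ ∧ q ≠ a₂ ∧ q ≠ w) ∨ (p = a₁ ∧ q = y) ∨
    (w ∈ S ∧ p = w ∧ q = z)
  refine hasSteinerTrees_two_of_rel (R₁ := R₁) (R₂ := R₂) (r₁ := a₁) (r₂ := a₂) ?_ ?_ ?_ ?_ ?_ ?_
  · grind
  · grind
  · grind
  · grind
  · intro s hs
    by_cases hs₁ : s = a₁
    · rw [hs₁]
    by_cases hs₂ : s = a₂
    · exact (reachable_fromRel (q := w) (by grind)).trans (reachable_fromRel (by grind))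
    by_cases hsy : s = y
    · have := (hy (hsy ▸ hs)).1.ne
      exact (reachable_fromRel (q := x) (by grind)).trans (reachable_fromRel (by grind))
    · exact reachable_fromRel (by grind)
  · intro s hs
    by_cases hs₁ : s = a₂
    · rw [hs₁]
    by_cases hs₂ : s = a₁
    · exact (reachable_fromRel (q := y) (by grind)).trans (reachable_fromRel (by grind))
    by_cases hsy : s = w
    · have := (hw (hsy ▸ hs)).1.ne
      exact (reachable_fromRel (q := z) (by grind)).trans (reachable_fromRel (by grind))
    · exact reachable_fromRel (by grind)

/-- As the first tree need not reach `a₂`, the star at `a₂` stays whole and only `y` has to be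
repaired. -/
lemma hasSteinerTrees_two_of_two_side_of_notMem (ha : a₁ ≠ a₂)
    (h₁ : ∀ b, b ≠ a₁ → b ≠ a₂ → G.Adj a₁ b) (h₂ : ∀ b, b ≠ a₁ → b ≠ a₂ → G.Adj a₂ b)
    (haS : a₂ ∉ S) {y x : V} (hy₁ : y ≠ a₁) (hy₂ : y ≠ a₂)
    (hy : y ∈ S → G.Adj y x ∧ x ≠ a₁ ∧ x ≠ a₂) : HasSteinerTrees G S 2 := by
  let R₁ : V → V → Prop := fun p q => (p = a₁ ∧ q ≠ a₁ ∧ q ≠ a₂ ∧ q ≠ y) ∨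
    (y ∈ S ∧ p = y ∧ q = x)
  let R₂ : V → V → Prop := fun p q => (p = a₂ ∧ q ≠ a₁ ∧ q ≠ a₂) ∨ (p = a₁ ∧ q = y)
  refine hasSteinerTrees_two_of_rel (R₁ := R₁) (R₂ := R₂) (r₁ := a₁) (r₂ := a₂) ?_ ?_ ?_ ?_ ?_ ?_
  · grind
  · grind
  · grind
  · grind
  · intro s hs
    by_cases hs₁ : s = a₁
    · rw [hs₁]
    by_cases hsy : s = y
    · have := (hy (hsy ▸ hs)).1.ne
      exact (reachable_fromRel (q := x) (by grind)).trans (reachable_fromRel (by grind))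
    · exact reachable_fromRel (by grind)
  · intro s hs
    by_cases hs₂ : s = a₁
    · exact (reachable_fromRel (q := y) (by grind)).trans (reachable_fromRel (by grind))
    · exact reachable_fromRel (by grind)

lemma hasSteinerTrees_two_of_two_side_of_notMem_of_notMem (ha : a₁ ≠ a₂)
    (h₁ : ∀ b, b ≠ a₁ → b ≠ a₂ → G.Adj a₁ b) (h₂ : ∀ b, b ≠ a₁ → b ≠ a₂ → G.Adj a₂ b)
    (haS₁ : a₁ ∉ S) (haS₂ : a₂ ∉ S) : HasSteinerTrees G S 2 := by
  let R₁ : V → V → Prop := fun p q => (p = a₁ ∧ q ≠ a₁ ∧ q ≠ a₂)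
  let R₂ : V → V → Prop := fun p q => (p = a₂ ∧ q ≠ a₁ ∧ q ≠ a₂)
  refine hasSteinerTrees_two_of_rel (R₁ := R₁) (R₂ := R₂) (r₁ := a₁) (r₂ := a₂) ?_ ?_ ?_ ?_ ?_ ?_
  · grind
  · grind
  · grind
  · grind
  · exact fun s hs => reachable_fromRel (by grind)
  · exact fun s hs => reachable_fromRel (by grind)

end TwoSide

lemma exists_equiv_sum_of_card [Fintype V] {A : Finset V} {a b : ℕ} (hA : A.card = a)
    (hn : Fintype.card V = a + b) :
    ∃ f : Fin a ⊕ Fin b ≃ V, (∀ i, f (Sum.inl i) ∈ A) ∧ ∀ j, f (Sum.inr j) ∉ A := by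
  classical
  have h1 : Fintype.card {x // x ∈ A} = a := by simpa using hA
  have h2 : Fintype.card {x // x ∉ A} = b := by
    rw [Fintype.card_subtype_compl, Fintype.card_coe]
    omega
  let f := (Equiv.sumCongr (Fintype.equivFinOfCardEq h1).symm
    (Fintype.equivFinOfCardEq h2).symm).trans (Equiv.sumCompl (· ∈ A))
  refine ⟨f, fun i => ?_, fun j => ?_⟩
  · exact ((Fintype.equivFinOfCardEq h1).symm i).2
  · exact ((Fintype.equivFinOfCardEq h2).symm j).2

section Join

variable [Fintype V] {G : SimpleGraph V} {A : Finset V}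

lemma isCopy_completeBip (hcross : ∀ a ∈ A, ∀ b ∉ A, G.Adj a b)
    (hA : ∀ a ∈ A, ∀ b ∈ A, ¬ G.Adj a b) (hB : ∀ a ∉ A, ∀ b ∉ A, ¬ G.Adj a b) {a b : ℕ}
    (hAa : A.card = a) (hn : Fintype.card V = a + b) : IsCopy G (completeBip a b) := by
  obtain ⟨f, h1, h2⟩ := exists_equiv_sum_of_card hAa hn
  refine isCopy_of_injective f f.injective (Fintype.card_congr f) ?_
  rintro (x | x) (y | y)
  · simpa using hA _ (h1 x) _ (h1 y)
  · simpa using hcross _ (h1 x) _ (h2 y)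
  · simpa using (hcross _ (h1 y) _ (h2 x)).symm
  · simpa using hB _ (h2 x) _ (h2 y)

lemma isK2Plus_of_join (hcross : ∀ a ∈ A, ∀ b ∉ A, G.Adj a b)
    (hA : ∀ a ∈ A, ∀ b ∈ A, ¬ G.Adj a b) {x y : V} (hx : x ∉ A) (hy : y ∉ A) (hxy : G.Adj x y)
    (hB : ∀ a ∉ A, ∀ b ∉ A, G.Adj a b → s(a, b) = s(x, y)) (hA2 : A.card = 2) {m : ℕ}
    (hn : Fintype.card V = 2 + m) : IsK2Plus G m := by
  obtain ⟨f, h1, h2⟩ := exists_equiv_sum_of_card hA2 hn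
  have hsurj : ∀ z ∉ A, ∃ j, f (Sum.inr j) = z := by
    intro z hz
    obtain ⟨i | j, rfl⟩ := f.surjective z
    · exact (hz (h1 i)).elim
    · exact ⟨j, rfl⟩
  obtain ⟨i, rfl⟩ := hsurj x hx
  obtain ⟨j, rfl⟩ := hsurj y hy
  have hij : i ≠ j := fun h => hxy.ne (h ▸ rfl)
  refine ⟨i, j, hij, isCopy_of_injective f f.injective (Fintype.card_congr f) ?_⟩
  rintro (x | x) (y | y)
  · simpa [edge_adj] using hA _ (h1 x) _ (h1 y)
  · simpa [edge_adj] using hcross _ (h1 x) _ (h2 y)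
  · simpa [edge_adj] using (hcross _ (h1 y) _ (h2 x)).symm
  · have h3 : G.Adj (f (Sum.inr x)) (f (Sum.inr y)) ↔ x ≠ y ∧ s(x, y) = s(i, j) := by
      constructor
      · intro h
        refine ⟨fun hxy => h.ne (hxy ▸ rfl), ?_⟩
        have := hB _ (h2 x) _ (h2 y) h
        simpa using this
      · rintro ⟨-, h⟩
        rcases Sym2.eq_iff.1 h with ⟨rfl, rfl⟩ | ⟨rfl, rfl⟩
        · exact hxy
        · exact hxy.symm
    rw [h3]
    simp only [sup_adj, completeBipartiteGraph_adj, edge_adj]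
    simp
    grind

/-- Two repairs are needed, and each is paid for by a vertex outside `S` or by an edge inside the
large side. Failure leaves at most one payment: no such edge and at most one vertex outside `S`, or
exactly one edge and `S` everything. -/
lemma isException_of_two_side {k : ℕ} {a₁ a₂ : V} (ha : a₁ ≠ a₂) (hk : 3 ≤ k)
    (hkn : k ≤ Fintype.card V) (h₁ : ∀ b, b ≠ a₁ → b ≠ a₂ → G.Adj a₁ b)
    (h₂ : ∀ b, b ≠ a₁ → b ≠ a₂ → G.Adj a₂ b) (hu : ∀ v, ∃ w, w ≠ v ∧ ¬ G.Adj v w)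
    {S : Finset V} (hS : S.card = k) (h : ¬ HasSteinerTrees G S 2) :
    IsException G (Fintype.card V) k := by
  classical
  have hna : ¬ G.Adj a₁ a₂ := by
    intro hadj
    obtain ⟨w, hw, hn⟩ := hu a₁
    by_cases hwa : w = a₂
    · exact hn (hwa ▸ hadj)
    · exact hn (h₁ w hw hwa)
  have hna' : ¬ G.Adj a₂ a₁ := fun h => hna h.symm
  have hcross : ∀ a ∈ ({a₁, a₂} : Finset V), ∀ b ∉ ({a₁, a₂} : Finset V), G.Adj a b := by
    intro a ha b hb
    simp only [Finset.mem_insert, Finset.mem_singleton, not_or] at ha hb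
    rcases ha with rfl | rfl
    · exact h₁ b hb.1 hb.2
    · exact h₂ b hb.1 hb.2
  have hA : ∀ a ∈ ({a₁, a₂} : Finset V), ∀ b ∈ ({a₁, a₂} : Finset V), ¬ G.Adj a b := by
    intro a ha b hb
    simp only [Finset.mem_insert, Finset.mem_singleton] at ha hb
    rcases ha with rfl | rfl <;> rcases hb with rfl | rfl <;> simp [hna, hna']
  have hA2 : ({a₁, a₂} : Finset V).card = 2 := Finset.card_pair ha
  have h₁' : ∀ b, b ≠ a₂ → b ≠ a₁ → G.Adj a₁ b := fun b h h' => h₁ b h' h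
  have h₂' : ∀ b, b ≠ a₂ → b ≠ a₁ → G.Adj a₂ b := fun b h h' => h₂ b h' h
  have hScard : Sᶜ.card = Fintype.card V - k := by rw [Finset.card_compl, hS]
  have hn : 4 ≤ Fintype.card V := by
    by_contra hcon
    obtain ⟨b, hb⟩ : ∃ b, b ∉ ({a₁, a₂} : Finset V) := by
      by_contra! hall
      have := Finset.card_le_card (show Finset.univ ⊆ ({a₁, a₂} : Finset V) from fun x _ => hall x)
      rw [Finset.card_univ] at this
      omega
    obtain ⟨w, hw, hbw⟩ := hu b
    have hwA : w ∉ ({a₁, a₂} : Finset V) := fun hwA => hbw (hcross w hwA b hb).symm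
    have hwA' : w ∉ insert b ({a₁, a₂} : Finset V) := by simp [hw] at hwA ⊢; exact hwA
    have := Finset.card_le_univ (insert w (insert b ({a₁, a₂} : Finset V)))
    rw [Finset.card_insert_of_notMem hwA', Finset.card_insert_of_notMem hb, hA2] at this
    omega
  by_cases hE : ∃ x y, x ∉ ({a₁, a₂} : Finset V) ∧ y ∉ ({a₁, a₂} : Finset V) ∧ G.Adj x y
  · obtain ⟨x, y, hx, hy, hxy⟩ := hE
    have hxA := hx
    have hyA := hy
    simp only [Finset.mem_insert, Finset.mem_singleton, not_or] at hx hy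
    have hSu : ∀ u, u ∈ S := by
      intro u
      by_contra huS
      apply h
      by_cases hu₁ : u = a₁
      · exact hasSteinerTrees_two_of_two_side_of_notMem ha.symm h₂' h₁' (hu₁ ▸ huS) hy.2 hy.1
          fun _ => ⟨hxy.symm, hx.2, hx.1⟩
      by_cases hu₂ : u = a₂
      · exact hasSteinerTrees_two_of_two_side_of_notMem ha h₁ h₂ (hu₂ ▸ huS) hy.1 hy.2
          fun _ => ⟨hxy.symm, hx.1, hx.2⟩
      by_cases hyu : y = u
      · exact hasSteinerTrees_two_of_two_side ha h₁ h₂ (w := u) (z := u)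
          (by rw [← hyu]; exact hxy.ne) hx.1 hx.2 hu₁ hu₂
          (fun _ => ⟨hxy, hy.1, hy.2⟩) (fun h => (huS h).elim) (fun _ h => (huS h).elim)
      · exact hasSteinerTrees_two_of_two_side ha h₁ h₂ (w := u) (z := u)
          hyu hy.1 hy.2 hu₁ hu₂
          (fun _ => ⟨hxy.symm, hx.1, hx.2⟩) (fun h => (huS h).elim) (fun _ h => (huS h).elim)
    have hkn' : k = Fintype.card V := by
      rw [← hS, Finset.eq_univ_of_forall hSu, Finset.card_univ]
    have hB : ∀ z ∉ ({a₁, a₂} : Finset V), ∀ w ∉ ({a₁, a₂} : Finset V), G.Adj z w →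
        s(z, w) = s(x, y) := by
      intro z hz w hw hzw
      simp only [Finset.mem_insert, Finset.mem_singleton, not_or] at hz hw
      by_contra hne
      have hne' : ¬ (z = x ∧ w = y) ∧ ¬ (z = y ∧ w = x) := by
        rw [Sym2.eq_iff] at hne
        tauto
      apply h
      by_cases hyw : y = w
      · exact hasSteinerTrees_two_of_two_side ha h₁ h₂ (y := x) (w := w) (x := y) (z := z)
          (hyw ▸ hxy.ne) hx.1 hx.2 hw.1 hw.2 (fun _ => ⟨hxy, hy.1, hy.2⟩)
          (fun _ => ⟨hzw.symm, hz.1, hz.2⟩) (fun _ _ hh => hne'.1 ⟨hh.2.symm, hh.1.symm⟩)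
      · exact hasSteinerTrees_two_of_two_side ha h₁ h₂ (y := y) (w := w) (x := x) (z := z)
          hyw hy.1 hy.2 hw.1 hw.2 (fun _ => ⟨hxy.symm, hx.1, hx.2⟩)
          (fun _ => ⟨hzw.symm, hz.1, hz.2⟩) (fun _ _ hh => hne'.2 ⟨hh.2.symm, hh.1.symm⟩)
    -- A non-neighbour of `x` is a third vertex of the large side; at order 4, `x` would be
    -- universal.
    have hn5 : 5 ≤ Fintype.card V := by
      by_contra hcon
      obtain ⟨w, hw, hxw⟩ := hu x
      have hwA : w ∉ ({a₁, a₂} : Finset V) := fun hwA => hxw (hcross w hwA x hxA).symm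
      have hwy : w ≠ y := fun hh => hxw (hh ▸ hxy)
      have e1 : x ∉ insert y ({a₁, a₂} : Finset V) := by
        simp only [Finset.mem_insert, not_or] at hxA ⊢
        exact ⟨hxy.ne, hxA⟩
      have e2 : w ∉ insert x (insert y ({a₁, a₂} : Finset V)) := by
        simp only [Finset.mem_insert, not_or] at hwA ⊢
        exact ⟨hw, hwy, hwA⟩
      have := Finset.card_le_univ (insert w (insert x (insert y ({a₁, a₂} : Finset V))))
      rw [Finset.card_insert_of_notMem e2, Finset.card_insert_of_notMem e1,
        Finset.card_insert_of_notMem hyA, hA2] at this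
      omega
    exact Or.inl ⟨hkn', hn5, Or.inl (isK2Plus_of_join hcross hA hxA hyA hxy hB hA2 (by omega))⟩
  · push Not at hE
    have hcopy : IsCopy G (completeBip 2 (Fintype.card V - 2)) :=
      isCopy_completeBip hcross hA (fun a ha b hb => hE a b ha hb) hA2 (by omega)
    have hk' : k = Fintype.card V ∨ k = Fintype.card V - 1 := by
      by_contra hcon
      obtain ⟨u, hu, u', hu', huu'⟩ := Finset.one_lt_card.1 (show 1 < Sᶜ.card by omega)
      rw [Finset.mem_compl] at hu hu'
      apply h
      have side : ∀ u u', u ∉ S → u' ∉ S → u ≠ u' → (u' = a₁ ∨ u' = a₂) → HasSteinerTrees G S 2 := by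
        rintro u u' hu hu' huu' (rfl | rfl)
        · by_cases hua : u = a₂
          · exact hasSteinerTrees_two_of_two_side_of_notMem_of_notMem ha h₁ h₂ hu' (hua ▸ hu)
          · exact hasSteinerTrees_two_of_two_side_of_notMem (x := u) ha.symm h₂' h₁' hu' hua huu'
              fun h => (hu h).elim
        · by_cases hua : u = a₁
          · exact hasSteinerTrees_two_of_two_side_of_notMem_of_notMem ha h₁ h₂ (hua ▸ hu) hu'
          · exact hasSteinerTrees_two_of_two_side_of_notMem (x := u) ha h₁ h₂ hu' hua huu'
              fun h => (hu h).elim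
      by_cases hu₁ : u' = a₁ ∨ u' = a₂
      · exact side u u' hu hu' huu' hu₁
      by_cases hu₂ : u = a₁ ∨ u = a₂
      · exact side u' u hu' hu huu'.symm hu₂
      rw [not_or] at hu₁ hu₂
      exact hasSteinerTrees_two_of_two_side (x := u) (z := u) ha h₁ h₂ huu' hu₂.1 hu₂.2 hu₁.1 hu₁.2
        (fun h => (hu h).elim) (fun h => (hu' h).elim) (fun h => (hu h).elim)
    by_cases hn4 : Fintype.card V = 4
    · have hC : IsCopy G (cycleGraph 4) := by
        rw [hn4] at hcopy
        obtain ⟨e⟩ := hcopy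
        exact ⟨e.trans cycleIso.symm⟩
      rcases hk' with hk' | hk'
      · exact Or.inr (Or.inr (Or.inl ⟨hk', hn4, Or.inl hC⟩))
      · exact Or.inr (Or.inr (Or.inr (Or.inr (Or.inr ⟨hk', by omega, hC⟩))))
    · rcases hk' with hk' | hk'
      · exact Or.inl ⟨hk', by omega, Or.inr hcopy⟩
      · exact Or.inr (Or.inr (Or.inr (Or.inr (Or.inl ⟨hk', by omega, hcopy⟩))))

end Join

/-! ### Joins with at least three vertices on each side -/

/-- Two disjoint connected spanning graphs on `W` extend to the whole vertex set if every further
vertex has two neighbours in `W`. -/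
lemma hasSteinerTrees_two_of_extend {G : SimpleGraph V} {R₁ R₂ : V → V → Prop}
    (h₁ : ∀ p q, R₁ p q → G.Adj p q) (h₂ : ∀ p q, R₂ p q → G.Adj p q)
    (hd : ∀ p q, R₁ p q → ¬ R₂ p q) (hd' : ∀ p q, R₁ p q → ¬ R₂ q p) {W : Set V}
    (hW₁ : ∀ p q, R₁ p q → p ∈ W ∧ q ∈ W) (hW₂ : ∀ p q, R₂ p q → p ∈ W ∧ q ∈ W)
    (hext : ∀ x, x ∉ W → ∃ p ∈ W, ∃ q ∈ W, p ≠ q ∧ G.Adj x p ∧ G.Adj x q) {r₁ r₂ : V}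
    (hr₁ : ∀ w ∈ W, (fromRel R₁).Reachable r₁ w) (hr₂ : ∀ w ∈ W, (fromRel R₂).Reachable r₂ w)
    (S : Finset V) : HasSteinerTrees G S 2 := by
  have hext' : ∀ x, ∃ p q, x ∉ W → p ∈ W ∧ q ∈ W ∧ p ≠ q ∧ G.Adj x p ∧ G.Adj x q := by
    intro x
    by_cases hx : x ∈ W
    -- Dummy values; `f` and `g` matter only outside `W`, where they attach `x` as a leaf to each
    -- subgraph.
    · exact ⟨x, x, fun h => (h hx).elim⟩
    · obtain ⟨p, hp, q, hq, h⟩ := hext x hx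
      exact ⟨p, q, fun _ => ⟨hp, hq, h⟩⟩
  choose f g hfg using hext'
  have hle : ∀ {R R' : V → V → Prop} {p q : V}, (∀ a b, R a b → R' a b) →
      (fromRel R).Reachable p q → (fromRel R').Reachable p q := by
    intro R R' p q h hpq
    refine hpq.mono fun a b hab => ?_
    exact ⟨hab.1, hab.2.imp (h _ _) (h _ _)⟩
  refine hasSteinerTrees_two_of_rel (R₁ := fun p q => R₁ p q ∨ (p ∉ W ∧ q = f p))
    (R₂ := fun p q => R₂ p q ∨ (p ∉ W ∧ q = g p)) (r₁ := r₁) (r₂ := r₂) ?_ ?_ ?_ ?_ ?_ ?_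
  · grind
  · grind
  · grind
  · grind
  · intro s _
    by_cases hs : s ∈ W
    · exact hle (fun _ _ => Or.inl) (hr₁ s hs)
    · exact (hle (fun _ _ => Or.inl) (hr₁ _ (hfg s hs).1)).trans
        (reachable_fromRel (Or.inr (Or.inr ⟨hs, rfl⟩)))
  · intro s _
    by_cases hs : s ∈ W
    · exact hle (fun _ _ => Or.inl) (hr₂ s hs)
    · exact (hle (fun _ _ => Or.inl) (hr₂ _ (hfg s hs).2.1)).trans
        (reachable_fromRel (Or.inr (Or.inr ⟨hs, rfl⟩)))

section Join

variable {G : SimpleGraph V} {A : Set V}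

/-- The 12 edges of `K_{3,4}` split into the spanning paths `b₁a₁b₂a₂b₃a₃b₄` and `b₃a₁b₄a₂b₁a₃b₂`,
the second being the first with the `b` indices shifted by two. -/
lemma hasSteinerTrees_two_of_three_four (hcross : ∀ a ∈ A, ∀ b ∉ A, G.Adj a b)
    {a₁ a₂ a₃ b₁ b₂ b₃ b₄ : V} (ha₁ : a₁ ∈ A) (ha₂ : a₂ ∈ A) (ha₃ : a₃ ∈ A)
    (hb₁ : b₁ ∉ A) (hb₂ : b₂ ∉ A) (hb₃ : b₃ ∉ A) (hb₄ : b₄ ∉ A)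
    (ha₁₂ : a₁ ≠ a₂) (ha₁₃ : a₁ ≠ a₃) (ha₂₃ : a₂ ≠ a₃) (hb₁₂ : b₁ ≠ b₂) (hb₁₃ : b₁ ≠ b₃)
    (hb₁₄ : b₁ ≠ b₄) (hb₂₃ : b₂ ≠ b₃) (hb₂₄ : b₂ ≠ b₄) (hb₃₄ : b₃ ≠ b₄) (S : Finset V) :
    HasSteinerTrees G S 2 := by
  let R₁ : V → V → Prop := fun p q => (p = a₁ ∧ (q = b₁ ∨ q = b₂)) ∨
    (p = a₂ ∧ (q = b₂ ∨ q = b₃)) ∨ (p = a₃ ∧ (q = b₃ ∨ q = b₄))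
  let R₂ : V → V → Prop := fun p q => (p = a₁ ∧ (q = b₃ ∨ q = b₄)) ∨
    (p = a₂ ∧ (q = b₄ ∨ q = b₁)) ∨ (p = a₃ ∧ (q = b₁ ∨ q = b₂))
  let W : Set V := {x | x = a₁ ∨ x = a₂ ∨ x = a₃ ∨ x = b₁ ∨ x = b₂ ∨ x = b₃ ∨ x = b₄}
  have e1 : (fromRel R₁).Reachable a₁ b₁ := reachable_fromRel (by grind)
  have e2 : (fromRel R₁).Reachable a₁ b₂ := reachable_fromRel (by grind)
  have e3 : (fromRel R₁).Reachable a₁ a₂ := e2.trans (reachable_fromRel (by grind))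
  have e4 : (fromRel R₁).Reachable a₁ b₃ := e3.trans (reachable_fromRel (by grind))
  have e5 : (fromRel R₁).Reachable a₁ a₃ := e4.trans (reachable_fromRel (by grind))
  have e6 : (fromRel R₁).Reachable a₁ b₄ := e5.trans (reachable_fromRel (by grind))
  have f1 : (fromRel R₂).Reachable a₁ b₃ := reachable_fromRel (by grind)
  have f2 : (fromRel R₂).Reachable a₁ b₄ := reachable_fromRel (by grind)
  have f3 : (fromRel R₂).Reachable a₁ a₂ := f2.trans (reachable_fromRel (by grind))
  have f4 : (fromRel R₂).Reachable a₁ b₁ := f3.trans (reachable_fromRel (by grind))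
  have f5 : (fromRel R₂).Reachable a₁ a₃ := f4.trans (reachable_fromRel (by grind))
  have f6 : (fromRel R₂).Reachable a₁ b₂ := f5.trans (reachable_fromRel (by grind))
  refine hasSteinerTrees_two_of_extend (R₁ := R₁) (R₂ := R₂) (W := W) (r₁ := a₁) (r₂ := a₁)
    ?_ ?_ ?_ ?_ ?_ ?_ ?_ ?_ ?_ S
  · grind
  · grind
  · grind
  · grind
  · grind
  · grind
  · intro x _
    by_cases hx : x ∈ A
    · exact ⟨b₁, by grind, b₂, by grind, hb₁₂, hcross x hx _ hb₁, hcross x hx _ hb₂⟩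
    · exact ⟨a₁, by grind, a₂, by grind, ha₁₂, (hcross _ ha₁ x hx).symm, (hcross _ ha₂ x hx).symm⟩
  · rintro w (rfl | rfl | rfl | rfl | rfl | rfl | rfl)
    exacts [Reachable.refl _, e3, e5, e1, e2, e4, e6]
  · rintro w (rfl | rfl | rfl | rfl | rfl | rfl | rfl)
    exacts [Reachable.refl _, f3, f5, f4, f6, f1, f2]

/-- A spanning tree containing the whole star at `a₁` leaves the path `b₁a₂b₃a₃b₂`, which misses
only `a₁`; the edge `a₁a₂` repairs this when `a₁` is in `S`. -/
lemma hasSteinerTrees_two_of_three_three (hcross : ∀ a ∈ A, ∀ b ∉ A, G.Adj a b)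
    {a₁ a₂ a₃ b₁ b₂ b₃ : V} (ha₁ : a₁ ∈ A) (ha₂ : a₂ ∈ A) (ha₃ : a₃ ∈ A)
    (hb₁ : b₁ ∉ A) (hb₂ : b₂ ∉ A) (hb₃ : b₃ ∉ A)
    (ha₁₂ : a₁ ≠ a₂) (ha₁₃ : a₁ ≠ a₃) (ha₂₃ : a₂ ≠ a₃) (hb₁₂ : b₁ ≠ b₂) (hb₁₃ : b₁ ≠ b₃)
    (hb₂₃ : b₂ ≠ b₃) (hall : ∀ x, x = a₁ ∨ x = a₂ ∨ x = a₃ ∨ x = b₁ ∨ x = b₂ ∨ x = b₃)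
    {S : Finset V} (h : a₁ ∈ S → G.Adj a₁ a₂) : HasSteinerTrees G S 2 := by
  let R₁ : V → V → Prop := fun p q => (p = a₁ ∧ (q = b₁ ∨ q = b₂ ∨ q = b₃)) ∨
    (p = a₂ ∧ q = b₂) ∨ (p = a₃ ∧ q = b₁)
  let R₂ : V → V → Prop := fun p q => (p = a₂ ∧ (q = b₁ ∨ q = b₃)) ∨
    (p = a₃ ∧ (q = b₃ ∨ q = b₂)) ∨ (a₁ ∈ S ∧ p = a₁ ∧ q = a₂)
  have e1 : (fromRel R₁).Reachable a₁ b₁ := reachable_fromRel (by grind)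
  have e2 : (fromRel R₁).Reachable a₁ b₂ := reachable_fromRel (by grind)
  have e3 : (fromRel R₁).Reachable a₁ b₃ := reachable_fromRel (by grind)
  have e4 : (fromRel R₁).Reachable a₁ a₂ := e2.trans (reachable_fromRel (by grind))
  have e5 : (fromRel R₁).Reachable a₁ a₃ := e1.trans (reachable_fromRel (by grind))
  have f1 : (fromRel R₂).Reachable a₂ b₁ := reachable_fromRel (by grind)
  have f2 : (fromRel R₂).Reachable a₂ b₃ := reachable_fromRel (by grind)
  have f3 : (fromRel R₂).Reachable a₂ a₃ := f2.trans (reachable_fromRel (by grind))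
  have f4 : (fromRel R₂).Reachable a₂ b₂ := f3.trans (reachable_fromRel (by grind))
  have f5 : a₁ ∈ S → (fromRel R₂).Reachable a₂ a₁ := fun _ => reachable_fromRel (by grind)
  refine hasSteinerTrees_two_of_rel (R₁ := R₁) (R₂ := R₂) (r₁ := a₁) (r₂ := a₂) ?_ ?_ ?_ ?_ ?_ ?_
  · grind
  · grind
  · grind
  · grind
  · intro s _
    rcases hall s with rfl | rfl | rfl | rfl | rfl | rfl
    exacts [Reachable.refl _, e4, e5, e1, e2, e3]
  · intro s hs
    rcases hall s with rfl | rfl | rfl | rfl | rfl | rfl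
    exacts [f5 hs, Reachable.refl _, f3, f1, f4, f2]

end Join

lemma two_le_card_of_cross {G : SimpleGraph V} {A : Finset V}
    (hcross : ∀ a ∈ A, ∀ b ∉ A, G.Adj a b) (hA : A.Nonempty)
    (hu : ∀ v, ∃ w, w ≠ v ∧ ¬ G.Adj v w) : 2 ≤ A.card := by
  obtain ⟨a, ha⟩ := hA
  obtain ⟨w, hw, hn⟩ := hu a
  have hwA : w ∈ A := by
    by_contra hwA
    exact hn (hcross a ha w hwA)
  exact Finset.one_lt_card.2 ⟨w, hwA, a, ha, hw⟩

section FinsetJoin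

variable [Fintype V] [DecidableEq V] {G : SimpleGraph V} {A S : Finset V}

lemma cross_compl (hcross : ∀ a ∈ A, ∀ b ∉ A, G.Adj a b) : ∀ a ∈ Aᶜ, ∀ b ∉ Aᶜ, G.Adj a b := by
  intro a ha b hb
  rw [Finset.mem_compl] at ha hb
  exact (hcross b (not_not.1 hb) a ha).symm

lemma hasSteinerTrees_two_of_card (hcross : ∀ a ∈ A, ∀ b ∉ A, G.Adj a b) (hA : 3 ≤ A.card)
    (hB : 4 ≤ Aᶜ.card) : HasSteinerTrees G S 2 := by
  obtain ⟨A', hA', hA'c⟩ := Finset.exists_subset_card_eq hA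
  obtain ⟨B', hB', hB'c⟩ := Finset.exists_subset_card_eq hB
  obtain ⟨a₁, a₂, a₃, h12, h13, h23, rfl⟩ := Finset.card_eq_three.1 hA'c
  obtain ⟨b₁, b₂, b₃, b₄, k12, k13, k14, k23, k24, k34, rfl⟩ := Finset.card_eq_four.1 hB'c
  have hb : ∀ b ∈ ({b₁, b₂, b₃, b₄} : Finset V), b ∉ (A : Set V) := fun b hb => by
    simpa using hB' hb
  exact hasSteinerTrees_two_of_three_four (A := (A : Set V)) hcross (hA' (by simp))
    (hA' (by simp)) (hA' (by simp)) (hb b₁ (by simp)) (hb b₂ (by simp)) (hb b₃ (by simp))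
    (hb b₄ (by simp)) h12 h13 h23 k12 k13 k14 k23 k24 k34 S

lemma hasSteinerTrees_two_of_card_three (hcross : ∀ a ∈ A, ∀ b ∉ A, G.Adj a b) (hA : A.card = 3)
    (hB : Aᶜ.card = 3) {a₁ a₂ : V} (ha₁ : a₁ ∈ A) (ha₂ : a₂ ∈ A) (hne : a₁ ≠ a₂)
    (h : a₁ ∈ S → G.Adj a₁ a₂) : HasSteinerTrees G S 2 := by
  obtain ⟨a₃, h3⟩ : ∃ a₃, (A.erase a₁).erase a₂ = {a₃} := by
    rw [← Finset.card_eq_one, Finset.card_erase_of_mem, Finset.card_erase_of_mem ha₁, hA]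
    exact Finset.mem_erase.2 ⟨hne.symm, ha₂⟩
  have h3' : ∀ x, (x ≠ a₂ ∧ x ≠ a₁ ∧ x ∈ A) ↔ x = a₃ := by
    intro x
    rw [← Finset.mem_singleton, ← h3, Finset.mem_erase, Finset.mem_erase]
  obtain ⟨h32, h31, h3A⟩ := (h3' a₃).2 rfl
  obtain ⟨b₁, b₂, b₃, k12, k13, k23, hb⟩ := Finset.card_eq_three.1 hB
  have hb' : ∀ x, x ∉ A ↔ x = b₁ ∨ x = b₂ ∨ x = b₃ := by
    intro x
    rw [← Finset.mem_compl, hb]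
    simp
  refine hasSteinerTrees_two_of_three_three (A := (A : Set V)) hcross ha₁ ha₂ h3A
    (b₁ := b₁) (b₂ := b₂) (b₃ := b₃) ?_ ?_ ?_ hne h31.symm h32.symm k12 k13 k23 ?_ h
  · exact (hb' b₁).2 (by simp)
  · exact (hb' b₂).2 (by simp)
  · exact (hb' b₃).2 (by simp)
  · intro x
    have := h3' x
    have := hb' x
    tauto

/-- A fourth vertex on either side gives `K_{3,4}`. With three on each, a vertex outside `S` or an
end of an edge within a side can play the role of `a₁`, so `S` is everything and both sides are
independent. -/
lemma isException_of_three_le {k : ℕ} (hcross : ∀ a ∈ A, ∀ b ∉ A, G.Adj a b) (hA : 3 ≤ A.card)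
    (hB : 3 ≤ Aᶜ.card) (hS : S.card = k) (h : ¬ HasSteinerTrees G S 2) :
    IsException G (Fintype.card V) k := by
  have hn := Finset.card_add_card_compl A
  have hB3 : Aᶜ.card = 3 := by
    by_contra hcon
    exact h (hasSteinerTrees_two_of_card hcross hA (by omega))
  have hA3 : A.card = 3 := by
    by_contra hcon
    exact h (hasSteinerTrees_two_of_card (cross_compl hcross) hB (by rw [compl_compl]; omega))
  have hcc : Aᶜᶜ.card = 3 := by rwa [compl_compl]
  have hSu : ∀ u, u ∈ S := by
    intro u
    by_contra hu
    apply h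
    by_cases huA : u ∈ A
    · obtain ⟨w, hw, hwu⟩ := Finset.exists_mem_ne (show 1 < A.card by omega) u
      exact hasSteinerTrees_two_of_card_three hcross hA3 hB3 huA hw hwu.symm fun h => (hu h).elim
    · obtain ⟨w, hw, hwu⟩ := Finset.exists_mem_ne (show 1 < Aᶜ.card by omega) u
      exact hasSteinerTrees_two_of_card_three (cross_compl hcross) hB3 hcc
        (Finset.mem_compl.2 huA) hw hwu.symm fun h => (hu h).elim
  have hk : k = Fintype.card V := by
    rw [← hS, Finset.eq_univ_of_forall hSu, Finset.card_univ]
  refine Or.inr (Or.inr (Or.inr (Or.inl ⟨hk, by omega, ?_⟩)))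
  refine isCopy_completeBip hcross (fun a ha b hb hab => h ?_) (fun a ha b hb hab => h ?_) hA3
    (by omega)
  · exact hasSteinerTrees_two_of_card_three hcross hA3 hB3 ha hb hab.ne fun _ => hab
  · exact hasSteinerTrees_two_of_card_three (cross_compl hcross) hB3 hcc
      (Finset.mem_compl.2 ha) (Finset.mem_compl.2 hb) hab.ne fun _ => hab

lemma isException_of_card_two {k : ℕ} (hcross : ∀ a ∈ A, ∀ b ∉ A, G.Adj a b) (hA : A.card = 2)
    (hk : 3 ≤ k) (hkn : k ≤ Fintype.card V) (hu : ∀ v, ∃ w, w ≠ v ∧ ¬ G.Adj v w)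
    (hS : S.card = k) (h : ¬ HasSteinerTrees G S 2) : IsException G (Fintype.card V) k := by
  obtain ⟨a₁, a₂, hne, rfl⟩ := Finset.card_eq_two.1 hA
  exact isException_of_two_side hne hk hkn
    (fun b h1 h2 => hcross a₁ (by simp) b (by simp [h1, h2]))
    (fun b h1 h2 => hcross a₂ (by simp) b (by simp [h1, h2])) hu hS h

end FinsetJoin

/-! ### The characterization -/

lemma exists_cross_of_not_connected_compl [Fintype V] [Nonempty V] {G : SimpleGraph V}
    (h : ¬ Gᶜ.Connected) : ∃ A : Finset V, A.Nonempty ∧ (∃ b, b ∉ A) ∧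
      ∀ a ∈ A, ∀ b ∉ A, G.Adj a b := by
  classical
  have hp : ¬ Gᶜ.Preconnected := fun hp => h { preconnected := hp }
  simp only [Preconnected, not_forall] at hp
  obtain ⟨u, v, huv⟩ := hp
  -- One side of the join is a component of the complement.
  refine ⟨Finset.univ.filter fun x => Gᶜ.Reachable u x, ⟨u, by simp⟩, ⟨v, by simpa using huv⟩, ?_⟩
  intro a ha b hb
  simp only [Finset.mem_filter, Finset.mem_univ, true_and] at ha hb
  by_contra hab
  refine hb (ha.trans (Adj.reachable ?_))
  rw [compl_adj]
  exact ⟨fun h => hb (h ▸ ha), hab⟩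

lemma Deficient.isExtremal [Fintype V] {G : SimpleGraph V} {k : ℕ} (hk : 3 ≤ k)
    (hkn : k ≤ Fintype.card V) (h : Deficient G k) : IsExtremal G k := by
  classical
  obtain ⟨hG, hG', S, hS, hT⟩ := h
  by_cases hu : ∃ v, ∀ w, w ≠ v → G.Adj v w
  · obtain ⟨v, hv⟩ := hu
    exact isExtremal_of_universal hk hkn hv hS hT
  push Not at hu
  have := hG.nonempty
  obtain ⟨A, hA, ⟨b, hb⟩, hcross⟩ := exists_cross_of_not_connected_compl hG'
  have hA2 := two_le_card_of_cross hcross hA hu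
  have hB2 := two_le_card_of_cross (cross_compl hcross) ⟨b, Finset.mem_compl.2 hb⟩ hu
  refine Or.inr (Or.inr ?_)
  rw [Nat.card_eq_fintype_card]
  by_cases hA' : A.card = 2
  · exact isException_of_card_two hcross hA' hk hkn hu hS hT
  by_cases hB' : Aᶜ.card = 2
  · exact isException_of_card_two (cross_compl hcross) hB' hk hkn hu hS hT
  · exact isException_of_three_le hcross (by omega) (by omega) hS hT

lemma deficient_iff_isExtremal [Fintype V] (G : SimpleGraph V) {k : ℕ} (hk : 3 ≤ k)
    (hkn : k ≤ Fintype.card V) : Deficient G k ↔ IsExtremal G k :=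
  ⟨Deficient.isExtremal hk hkn, Deficient.of_isExtremal hk hkn⟩

end GenEdgeConn

theorem proposition3 {V : Type*} [Fintype V] (G : SimpleGraph V) (k : ℕ)
    (hk : 3 ≤ k) (hkn : k ≤ Fintype.card V) :
    GenEdgeConn.genLambda G k + GenEdgeConn.genLambda Gᶜ k = 1 ↔
      (GenEdgeConn.IsExtremal G k ∨ GenEdgeConn.IsExtremal Gᶜ k) := by
  rw [GenEdgeConn.genLambda_add_eq_one_iff G (by omega) hkn,
    GenEdgeConn.deficient_iff_isExtremal G hk hkn, GenEdgeConn.deficient_iff_isExtremal Gᶜ hk hkn]
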